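/- For a permutation $\pi=\pi_1\pi_2\cdots\pi_n$ of $\{1,\dots,n\}$, a position $i$ with $1<i<n$ is a peak if $\pi_{i-1}<\pi_i>\pi_{i+1}$ and a valley if $\pi_{i-1}>\pi_i<\pi_{i+1}$. Let $f(n)$ be the number of permutations of $\{1,\dots,n\}$ all of whose valleys are at even positions and all of whose peaks are at odd positions. Let $$D(z)=3\cos\left(\tfrac12 z\right)-\sqrt3\,\sinh\left(\tfrac12\sqrt3\,z\right),\qquad z\in\mathbb C.$$ Then $D$ has a unique zero $\alpha$ of smallest modulus, and $\alpha$ is real and positive; let $\gamma$ be the smallest modulus of a zero of $D$ other than $\alpha$ (it is attained), so that $\gamma>\alpha$. Put $\beta=1/\alpha$ and $\delta=1/\gamma$. Then $\beta=0.7693323706\cdots$, $\delta=0.3049639859\cdots$ (truncated decimal expansions), and $$\frac{f(n)}{n!}=2\beta^{n+1}+O(\delta^n)\qquad\text{as } n\to\infty.$$ -/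

import Mathlib

open Filter Asymptotics

namespace PeaksValleys

/-- The one-based position `i` is a peak of the permutation `π = π₁ π₂ ⋯ πₙ`, that is,
`1 < i < n` and `π_{i-1} < π_i > π_{i+1}`. Here `a`, `b`, `c` are the zero-based indices of
the one-based positions `i - 1`, `i`, `i + 1`. -/
def IsPeak {n : ℕ} (π : Equiv.Perm (Fin n)) (i : ℕ) : Prop :=
  ∃ a b c : Fin n, (a : ℕ) + 1 + 1 = i ∧ (b : ℕ) + 1 = i ∧ (c : ℕ) + 1 = i + 1 ∧
    π a < π b ∧ π c < π b

/-- The one-based position `i` is a valley of `π`, that is, `1 < i < n` and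
`π_{i-1} > π_i < π_{i+1}`. -/
def IsValley {n : ℕ} (π : Equiv.Perm (Fin n)) (i : ℕ) : Prop :=
  ∃ a b c : Fin n, (a : ℕ) + 1 + 1 = i ∧ (b : ℕ) + 1 = i ∧ (c : ℕ) + 1 = i + 1 ∧
    π b < π a ∧ π b < π c

/-- All valleys of `π` are even and all peaks of `π` are odd. -/
def ValleysEvenPeaksOdd {n : ℕ} (π : Equiv.Perm (Fin n)) : Prop :=
  (∀ i : ℕ, IsValley π i → Even i) ∧ (∀ i : ℕ, IsPeak π i → Odd i)

/-- The number of `n`-permutations with all valleys even and all peaks odd. -/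
noncomputable def f (n : ℕ) : ℕ :=
  Nat.card {π : Equiv.Perm (Fin n) // ValleysEvenPeaksOdd π}

/-- The entire function `D(z) = 3 cos(z/2) - √3 sinh(√3 z/2)`. -/
noncomputable def D (z : ℂ) : ℂ :=
  3 * Complex.cos (z / 2) - (Real.sqrt 3 : ℂ) * Complex.sinh ((Real.sqrt 3 : ℂ) * z / 2)

end PeaksValleys

/-!
The counting problem is about words over a totally ordered alphabet. Call the steps of a word
proper when they are alternately a descent, an ascent, a descent, …; all valleys are even and all
peaks are odd exactly when no two consecutive steps are improper (`Alt false`). Let `F` be the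
exponential generating function of the number of such words, and `A` that of the words whose last
step is moreover proper (`Alt true`). Splitting a word at its largest letter (`cnt_insert_max`)
gives, with `e` and `o` for the even and odd part of a series, the system `F' = Fₑ F + Aₒ`,
`A' = Fₑ A`, `F 0 = A 0 = 1`, which has only one solution (`IsSolution.ext`). A solution is
`F = -2 D' / D`, `A z = D (-z) / D z` (`isSolution_DSeries`). Thus `f n / n!` is the `n`-th Taylor
coefficient of `-2 D' / D`. Every zero of `D` is a simple pole of this function with residue `-2`,
so a zero `a` contributes `2 a⁻¹ ^ (n + 1)` to that coefficient, and the theorem becomes a statement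
about the zeros of `D` in the disc `|z| ≤ 3.28` (`exists_norm_coeff_logDeriv_le`).

In this disc `D` has one real zero `α` and one pair of conjugate zeros `ρ`, `conj ρ`. For `y > 0` the
imaginary part of `D (x + i y)` can only vanish if `x < 0`; write `x = -s`. Comparing squared moduli
in `3 cos (z / 2) = √3 sinh (√3 z / 2)` yields `3 cosh y + cos (√3 y) = cosh (√3 s) - 3 cos s`
(`modulus_relation`), so `y` is an increasing function of `s` on the zero set, while the real part of
the equation makes it a decreasing one (`strictMonoOn_neg_cos_div_cosh`); hence there is at most one
zero with `y > 0` (`upper_zero_unique`). The zeros exist and are located to ten digits by evaluating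
the Taylor polynomials of `D` at rational points: a sign change gives `α`, and an effective open
mapping theorem near a rational point at which `D` is almost zero gives `ρ`.
-/

namespace PeaksValleys

/-- `Alt e r l` says that `l = a₁ a₂ a₃ ⋯` has no two consecutive improper steps, where the steps
`a₁ a₂`, `a₂ a₃`, `a₃ a₄`, … are proper when they are, alternately, a descent, an ascent, a
descent, … for the order `r`. If `e = true`, then moreover the last step, if there is one, has to be
proper. -/
def Alt {α : Type} (e : Bool) : (α → α → Prop) → List α → Prop
  | _, [] => True
  | _, [_] => True
  | r, [a, b] => e = true → r b a
  | r, a :: b :: c :: l => ¬(r a b ∧ r c b) ∧ Alt e (flip r) (b :: c :: l)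

/-! ### Words without two consecutive improper steps, cut at their largest letter -/

section Split

variable {α : Type} {r : α → α → Prop} {m : α}

theorem alt_cons_max {e : Bool} {τ : List α} (hτ : ∀ x ∈ τ, r x m ∧ ¬ r m x) :
    Alt e r (m :: τ) ↔ Alt e (flip r) τ := by
  match τ with
  | [] => simp [Alt]
  | [z] => have := hτ z (by simp); simp [Alt, this]
  | z :: w :: l => have := hτ z (by simp); simp [Alt, this]

/-- If the largest letter `m` has an even number of letters before it, it is preceded by a proper
step (an ascent) and followed by a proper one (a descent), so the two sides are independent. The
roles of ascents and descents are exchanged after `m`. -/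
theorem alt_append_max_of_even {e : Bool} {τ : List α} (hτ : ∀ x ∈ τ, r x m ∧ ¬ r m x) :
    ∀ {σ : List α}, (∀ x ∈ σ, r x m ∧ ¬ r m x) → Even σ.length →
      (Alt e r (σ ++ m :: τ) ↔ Alt false r σ ∧ Alt e (flip r) τ)
  | [], _, _ => by simp [Alt, alt_cons_max hτ]
  | [_], _, h => by simp at h
  | [a, b], hσ, _ => by
    have hb := hσ b (by simp)
    match τ with
    | [] => simp [Alt, flip, hb]
    | z :: l =>
      have := alt_cons_max (e := e) hτ
      simp [Alt, flip, hb] at this ⊢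
      exact this
  | [_, _, _], _, h => by simp [Nat.even_add_one] at h
  | a :: b :: c :: d :: σ, hσ, h => by
    have ih := alt_append_max_of_even (e := e) hτ (σ := c :: d :: σ)
      (fun x hx => hσ x (by simp at hx ⊢; tauto)) (by simpa [Nat.even_add_one] using h)
    have h1 : flip (flip r) = r := rfl
    simp only [List.cons_append, Alt, h1] at ih ⊢
    rw [ih]
    tauto

/-- If the largest letter `m` has an odd number of letters before it, the steps before and after `m`
are both improper. So `m` has to be the last letter, and the step before the improper last one has
to be proper. -/
theorem alt_append_max_of_odd [IsStrictTotalOrder α r] {e : Bool} {τ : List α}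
    (hτ : ∀ x ∈ τ, r x m ∧ ¬ r m x) :
    ∀ {σ : List α}, (∀ x ∈ σ, r x m ∧ ¬ r m x) → σ.Nodup → ¬ Even σ.length →
      (Alt e r (σ ++ m :: τ) ↔ e = false ∧ τ = [] ∧ Alt true r σ)
  | [], _, _, h => by simp at h
  | [x], hσ, _, _ => by
    have hx := hσ x (by simp)
    match τ with
    | [] => simp [Alt, hx]
    | z :: l => have := hτ z (by simp); simp [Alt, hx, this]
  | [_, _], _, _, h => by simp at h
  | [a, b, c], hσ, hd, _ => by
    have hc := hσ c (by simp)
    have hbc : ¬ r c b ↔ r b c := by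
      have hne : b ≠ c := by simp at hd; tauto
      constructor
      · intro h
        rcases trichotomous_of r b c with h1 | h1 | h1
        · exact h1
        · exact absurd h1 hne
        · exact absurd h1 h
      · exact fun h h' => asymm_of r h h'
    have ih := alt_append_max_of_odd (e := e) hτ (σ := [c]) (by simpa using hc) (by simp) (by simp)
    have h1 : flip (flip r) = r := rfl
    simp only [List.cons_append, List.nil_append, Alt, h1] at ih ⊢
    rw [ih]
    simp [flip, hc, ← hbc]
    tauto
  | [_, _, _, _], _, _, h => by simp [Nat.even_add_one] at h
  | a :: b :: c :: d :: x :: σ, hσ, hd, h => by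
    have ih := alt_append_max_of_odd (e := e) hτ (σ := c :: d :: x :: σ)
      (fun x hx => hσ x (by simp at hx ⊢; tauto)) (hd.sublist (by simp))
      (by simpa [Nat.even_add_one] using h)
    have h1 : flip (flip r) = r := rfl
    simp only [List.cons_append, Alt, h1] at ih ⊢
    rw [ih]
    tauto

end Split

/-! ### Counting the orderings of a finite set -/

section Count

/-- The lists without repetition whose set of entries is `S`. -/
noncomputable def orderings {α : Type} (S : Finset α) : Finset (List α) :=
  ⟨S.val.lists, Multiset.lists_nodup_finset S⟩

open Classical in
/-- The number of orderings of the finite set `S` into a list satisfying `Alt e r`. -/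
noncomputable def cnt {α : Type} (e : Bool) (r : α → α → Prop) (S : Finset α) : ℕ :=
  ((orderings S).filter (Alt e r)).card

theorem mem_orderings {α : Type} [DecidableEq α] {S : Finset α} {l : List α} :
    l ∈ orderings S ↔ l.Nodup ∧ l.toFinset = S := by
  rw [orderings, Finset.mem_mk, Multiset.mem_lists_iff]
  constructor
  · intro h
    have h' : S.val = (l : Multiset α) := h
    have hn : l.Nodup := by rw [← Multiset.coe_nodup, ← h']; exact S.nodup
    refine ⟨hn, ?_⟩
    ext x
    rw [List.mem_toFinset, ← Finset.mem_val, h', Multiset.mem_coe]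
  · rintro ⟨hn, rfl⟩
    exact (List.toFinset_val l).trans (by rw [hn.dedup]; rfl)

theorem cnt_empty {α : Type} (e : Bool) (r : α → α → Prop) : cnt e r (∅ : Finset α) = 1 := by
  classical
  have : orderings (∅ : Finset α) = {[]} := by
    ext l; rw [mem_orderings]; simp; rintro rfl; simp
  simp [cnt, this, Finset.filter_singleton, Alt]

open Classical in
/-- Splitting the orderings at the largest letter `m`; `T` is the set of letters before `m`. -/
theorem cnt_insert_max {α : Type} (e : Bool) (r : α → α → Prop) [IsStrictTotalOrder α r]
    {S : Finset α} {m : α} (hm : ∀ x ∈ S, r x m) :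
    cnt e r (insert m S) =
      (∑ T ∈ S.powerset, if Even T.card then cnt false r T * cnt e (flip r) (S \ T) else 0) +
        if e = false ∧ ¬ Even S.card then cnt true r S else 0 := by
  have hmS : m ∉ S := fun h => irrefl_of r m (hm m h)
  have hm' : ∀ x ∈ S, r x m ∧ ¬ r m x := fun x hx => ⟨hm x hx, fun h => asymm_of r h (hm x hx)⟩
  have key : cnt e r (insert m S) = (S.powerset.sigma fun T =>
      (orderings T ×ˢ orderings (S \ T)).filter
        fun p => Alt e r (p.1 ++ m :: p.2)).card := by
    symm
    refine Finset.card_bij (fun p _ => p.2.1 ++ m :: p.2.2) ?_ ?_ ?_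
    · rintro ⟨T, σ, τ⟩ h
      simp only [Finset.mem_sigma, Finset.mem_powerset, Finset.mem_filter, Finset.mem_product,
        mem_orderings] at h ⊢
      obtain ⟨hT, ⟨⟨h1, h2⟩, h3, h4⟩, h5⟩ := h
      refine ⟨⟨?_, ?_⟩, h5⟩
      · have ha : ∀ x, x ∈ σ ↔ x ∈ T := by simp [← h2]
        have hb : ∀ x, x ∈ τ ↔ x ∈ S \ T := by simp [← h4]
        rw [List.nodup_append]
        refine ⟨h1, ?_, ?_⟩
        · rw [List.nodup_cons, hb]
          exact ⟨by simp [hmS], h3⟩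
        · intro a hσ b hτ hab
          subst hab
          rw [ha] at hσ
          rw [List.mem_cons, hb] at hτ
          rcases hτ with rfl | hτ
          · exact hmS (hT hσ)
          · simp [hσ] at hτ
      · rw [List.toFinset_append, List.toFinset_cons, h2, h4, Finset.union_insert,
          Finset.union_sdiff_of_subset hT]
    · rintro ⟨T, σ, τ⟩ h ⟨T', σ', τ'⟩ h' heq
      simp only [Finset.mem_sigma, Finset.mem_powerset, Finset.mem_filter, Finset.mem_product,
        mem_orderings] at h h' heq
      obtain ⟨hT, ⟨⟨h1, rfl⟩, h3, h4⟩, h5⟩ := h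
      obtain ⟨hT', ⟨⟨h1', rfl⟩, h3', h4'⟩, h5'⟩ := h'
      have a1 : m ∉ σ := fun h => hmS (hT (by simpa using h))
      have a3 : m ∉ τ := fun h => by
        have : m ∈ τ.toFinset := by simpa using h
        rw [h4] at this; simp [hmS] at this
      obtain ⟨rfl, -, rfl⟩ := (List.append_cons_inj_of_notMem a1 a3).1 heq
      rfl
    · intro l hl
      simp only [Finset.mem_filter, mem_orderings] at hl
      obtain ⟨⟨hn, hS⟩, hA⟩ := hl
      have hml : m ∈ l := by
        have : m ∈ l.toFinset := by rw [hS]; simp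
        simpa using this
      obtain ⟨σ, τ, rfl⟩ := List.append_of_mem hml
      rw [List.nodup_append] at hn
      obtain ⟨n1, n2, n3⟩ := hn
      rw [List.nodup_cons] at n2
      have hmem : ∀ x, (x ∈ σ ∨ x = m ∨ x ∈ τ) ↔ (x = m ∨ x ∈ S) := by
        intro x
        have := Finset.ext_iff.1 hS x
        simpa [or_left_comm] using this
      have hmσ : m ∉ σ := fun h => n3 m h m (by simp) rfl
      refine ⟨⟨σ.toFinset, σ, τ⟩, ?_, rfl⟩
      simp only [Finset.mem_sigma, Finset.mem_powerset, Finset.mem_filter, Finset.mem_product,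
        mem_orderings]
      refine ⟨?_, ⟨⟨n1, trivial⟩, n2.2, ?_⟩, hA⟩
      · intro x hx
        rw [List.mem_toFinset] at hx
        rcases (hmem x).1 (Or.inl hx) with rfl | h
        · exact absurd hx hmσ
        · exact h
      · ext x
        simp only [List.mem_toFinset, Finset.mem_sdiff]
        constructor
        · intro hx
          refine ⟨?_, fun h => n3 x h x (by simp [hx]) rfl⟩
          rcases (hmem x).1 (Or.inr (Or.inr hx)) with rfl | h
          · exact absurd hx n2.1
          · exact h
        · rintro ⟨hx, hx'⟩
          rcases (hmem x).2 (Or.inr hx) with h | rfl | h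
          · exact absurd h hx'
          · exact absurd hx hmS
          · exact h
  rw [key, Finset.card_sigma]
  -- The orderings with an odd number of letters before `m` all belong to `T = S`.
  have hterm : ∀ T ∈ S.powerset,
      ((orderings T ×ˢ orderings (S \ T)).filter fun p => Alt e r (p.1 ++ m :: p.2)).card =
      (if Even T.card then cnt false r T * cnt e (flip r) (S \ T) else 0) +
        if T = S then (if e = false ∧ ¬ Even S.card then cnt true r S else 0) else 0 := by
    intro T hT
    rw [Finset.mem_powerset] at hT
    have hp : ∀ p ∈ orderings T ×ˢ orderings (S \ T), (∀ x ∈ p.1, r x m ∧ ¬ r m x) ∧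
        (∀ x ∈ p.2, r x m ∧ ¬ r m x) ∧ p.1.Nodup ∧ p.1.length = T.card := by
      rintro ⟨σ, τ⟩ h
      simp only [Finset.mem_product, mem_orderings] at h
      obtain ⟨⟨h1, h2⟩, h3, h4⟩ := h
      refine ⟨fun x hx => hm' x (hT (by simpa [← h2] using hx)), fun x hx => hm' x ?_, h1, ?_⟩
      · have : x ∈ τ.toFinset := by simpa using hx
        rw [h4] at this
        exact (Finset.mem_sdiff.1 this).1
      · rw [← h2, List.toFinset_card_of_nodup h1]
    by_cases hev : Even T.card
    · have h2 : (if T = S then (if e = false ∧ ¬ Even S.card then cnt true r S else 0) else 0)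
          = 0 := by
        split_ifs with h h' <;> simp_all
      rw [if_pos hev, h2, add_zero, cnt, cnt, ← Finset.card_product, ← Finset.filter_product]
      congr 1
      refine Finset.filter_congr fun p hpm => ?_
      obtain ⟨b1, b2, -, b4⟩ := hp p hpm
      exact alt_append_max_of_even b2 b1 (b4 ▸ hev)
    · rw [if_neg hev, zero_add]
      have hA : ∀ p ∈ orderings T ×ˢ orderings (S \ T),
          (Alt e r (p.1 ++ m :: p.2) ↔ e = false ∧ p.2 = [] ∧ Alt true r p.1) := by
        intro p hpm
        obtain ⟨b1, b2, b3, b4⟩ := hp p hpm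
        exact alt_append_max_of_odd b2 b1 b3 (b4 ▸ hev)
      rw [Finset.filter_congr hA]
      by_cases hTS : T = S
      · subst hTS
        rw [if_pos rfl]
        by_cases he : e = false
        · rw [if_pos ⟨he, hev⟩, cnt]
          refine Finset.card_bij (fun p _ => p.1) ?_ ?_ ?_
          · rintro ⟨σ, τ⟩ h
            simp only [Finset.mem_filter, Finset.mem_product] at h ⊢
            tauto
          · rintro ⟨σ, τ⟩ h ⟨σ', τ'⟩ h' heq
            simp only [Finset.mem_filter] at h h' heq
            rw [heq, h.2.2.1, h'.2.2.1]
          · intro l hl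
            simp only [Finset.mem_filter] at hl
            refine ⟨(l, []), ?_, rfl⟩
            simp only [Finset.mem_filter, Finset.mem_product, mem_orderings (S := T \ T)]
            exact ⟨⟨hl.1, by simp⟩, he, trivial, hl.2⟩
        · rw [if_neg (by tauto), Finset.card_eq_zero, Finset.filter_eq_empty_iff]
          tauto
      · rw [if_neg hTS, Finset.card_eq_zero, Finset.filter_eq_empty_iff]
        rintro ⟨σ, τ⟩ hpm ⟨-, h, -⟩
        simp only [Finset.mem_product, mem_orderings] at hpm h
        rw [h] at hpm
        have := hpm.2.2
        simp only [List.toFinset_nil] at this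
        exact hTS (hT.antisymm (Finset.sdiff_eq_empty_iff_subset.1 this.symm))
  rw [Finset.sum_congr rfl hterm, Finset.sum_add_distrib]
  congr 1
  rw [Finset.sum_ite_eq' S.powerset S, if_pos (Finset.mem_powerset_self S)]

theorem exists_max_insert {α : Type} [DecidableEq α] (r : α → α → Prop) [IsStrictTotalOrder α r]
    {n : ℕ} {S : Finset α} (hS : S.card = n + 1) :
    ∃ (m : α) (S' : Finset α), S = insert m S' ∧ S'.card = n ∧ ∀ x ∈ S', r x m := by
  classical
  let _ := linearOrderOfSTO r
  have hne : S.Nonempty := Finset.card_pos.1 (by omega)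
  refine ⟨S.max' hne, S.erase (S.max' hne), ?_, ?_, ?_⟩
  · ext x; by_cases hx : x = S.max' hne <;> simp [hx, S.max'_mem hne]
  · rw [Finset.card_erase_of_mem (S.max'_mem hne)]; omega
  · intro x hx
    exact S.lt_max'_of_mem_erase_max' hne hx

/-- The number of words on `n` letters satisfying `Alt e`. -/
noncomputable def altCount (e : Bool) (n : ℕ) : ℕ :=
  cnt e (· < ·) (Finset.range n)

theorem cnt_succ_of_forall_le {n : ℕ}
    (ih : ∀ k ≤ n, ∀ {α : Type} (e : Bool) (r : α → α → Prop) [IsStrictTotalOrder α r]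
      {S : Finset α}, S.card = k → cnt e r S = altCount e k)
    {α : Type} (e : Bool) (r : α → α → Prop) [IsStrictTotalOrder α r]
    {S : Finset α} (hS : S.card = n + 1) :
    cnt e r S =
      (∑ k ∈ Finset.range (n + 1),
        n.choose k * if Even k then altCount false k * altCount e (n - k) else 0) +
        if e = false ∧ ¬ Even n then altCount true n else 0 := by
  classical
  obtain ⟨m, S, rfl, hS', hm⟩ := exists_max_insert r hS
  have : IsStrictTotalOrder α (flip r) := inferInstanceAs (IsStrictTotalOrder α (Function.swap r))
  have hterm : ∀ T ∈ S.powerset,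
      (if Even T.card then cnt false r T * cnt e (flip r) (S \ T) else 0) =
        (fun k => if Even k then altCount false k * altCount e (n - k) else 0) T.card := by
    intro T hT
    rw [Finset.mem_powerset] at hT
    have hle : T.card ≤ n := hS' ▸ Finset.card_le_card hT
    simp only
    rw [ih _ hle false r rfl, ih (n - T.card) (by omega) e (flip r)
      (by rw [Finset.card_sdiff_of_subset hT, hS'])]
  rw [cnt_insert_max e r hm, Finset.sum_congr rfl hterm,
    Finset.sum_powerset_apply_card (fun k => if Even k then altCount false k * altCount e (n - k)
      else 0), ih n le_rfl true r hS', hS']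
  simp only [smul_eq_mul]

/-- The count depends only on the number of letters, and is the same for an order and its dual. -/
theorem cnt_eq_altCount (n : ℕ) : ∀ {α : Type} (e : Bool) (r : α → α → Prop)
    [IsStrictTotalOrder α r] {S : Finset α}, S.card = n → cnt e r S = altCount e n := by
  induction n using Nat.strong_induction_on with
  | _ n ih =>
    intro α e r _ S hS
    rcases n with _ | n
    · rw [Finset.card_eq_zero] at hS
      subst hS
      rw [altCount, Finset.range_zero, cnt_empty, cnt_empty]
    · have ih' : ∀ k ≤ n, ∀ {α : Type} (e : Bool) (r : α → α → Prop) [IsStrictTotalOrder α r]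
          {S : Finset α}, S.card = k → cnt e r S = altCount e k :=
        fun k hk => ih k (by omega)
      rw [cnt_succ_of_forall_le ih' e r hS]
      exact (cnt_succ_of_forall_le ih' e (· < ·) (Finset.card_range (n + 1))).symm

theorem altCount_zero (e : Bool) : altCount e 0 = 1 := by
  rw [altCount, Finset.range_zero, cnt_empty]

/-- The recurrence whose exponential generating function is the system `IsSolution`. -/
theorem altCount_succ (e : Bool) (n : ℕ) :
    altCount e (n + 1) =
      (∑ k ∈ Finset.range (n + 1),
        n.choose k * if Even k then altCount false k * altCount e (n - k) else 0) +
        if e = false ∧ ¬ Even n then altCount true n else 0 := by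
  conv_lhs => rw [altCount]
  exact cnt_succ_of_forall_le (fun k _ => cnt_eq_altCount k) e _ (Finset.card_range (n + 1))

end Count

/-! ### From words to permutations -/

section Permutations

/-- With zero-based indices, `i + 1` is the middle of the window `i, i + 1, i + 2`; it is an even
position in the one-based count exactly when `i` is even. -/
theorem alt_false_iff {α : Type} : ∀ {l : List α} {r : α → α → Prop}, Alt false r l ↔
    ∀ i, ∀ h : i + 2 < l.length,
      (Even i → ¬ (r l[i] l[i + 1] ∧ r l[i + 2] l[i + 1])) ∧
      (¬ Even i → ¬ (r l[i + 1] l[i] ∧ r l[i + 1] l[i + 2]))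
  | [], _ => by simp [Alt]
  | [_], _ => by simp [Alt]
  | [a, b], _ => by simp [Alt]
  | a :: b :: c :: l, r => by
    rw [Alt, alt_false_iff]
    constructor
    · rintro ⟨h1, h2⟩ i hi
      rcases i with _ | i
      · exact ⟨fun _ => h1, fun h => absurd Even.zero h⟩
      · have := h2 i (by simpa using hi)
        rw [Nat.even_add_one, not_not]
        exact ⟨this.2, this.1⟩
    · intro h
      refine ⟨(h 0 (by simp)).1 Even.zero, fun i hi => ?_⟩
      have := h (i + 1) (by simpa using hi)
      rw [Nat.even_add_one, not_not] at this
      exact ⟨this.2, this.1⟩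

theorem valleysEvenPeaksOdd_iff {n : ℕ} (π : Equiv.Perm (Fin n)) :
    ValleysEvenPeaksOdd π ↔ Alt false (· < ·) (List.ofFn π) := by
  rw [alt_false_iff]
  simp only [List.getElem_ofFn, List.length_ofFn]
  constructor
  · rintro ⟨hv, hp⟩ i hi
    constructor
    · intro hev h
      have := hp (i + 2) ⟨⟨i, by omega⟩, ⟨i + 1, by omega⟩, ⟨i + 2, by omega⟩, rfl, rfl, rfl, h⟩
      exact Nat.not_even_iff_odd.2 this (by simpa [Nat.even_add] using hev)
    · intro hod h
      have := hv (i + 2) ⟨⟨i, by omega⟩, ⟨i + 1, by omega⟩, ⟨i + 2, by omega⟩, rfl, rfl, rfl, h⟩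
      exact hod (by simpa [Nat.even_add] using this)
  · intro H
    constructor
    · rintro i ⟨⟨a, ha⟩, ⟨b, hb⟩, ⟨c, hc⟩, h1, h2, h3, h⟩
      simp only at h1 h2 h3
      obtain rfl : b = a + 1 := by omega
      obtain rfl : c = a + 2 := by omega
      by_contra hod
      rw [← h1] at hod
      exact (H a hc).2 (by simpa [Nat.even_add] using hod) h
    · rintro i ⟨⟨a, ha⟩, ⟨b, hb⟩, ⟨c, hc⟩, h1, h2, h3, h⟩
      simp only at h1 h2 h3
      obtain rfl : b = a + 1 := by omega
      obtain rfl : c = a + 2 := by omega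
      by_contra hod
      rw [← h1, Nat.not_odd_iff_even] at hod
      exact (H a hc).1 (by simpa [Nat.even_add] using hod) h

theorem f_eq_altCount (n : ℕ) : f n = altCount false n := by
  classical
  rw [← cnt_eq_altCount n false (· < ·) (S := (Finset.univ : Finset (Fin n))) (by simp), cnt, f,
    Nat.card_eq_fintype_card, Fintype.card_subtype]
  refine Finset.card_bij (fun π _ => List.ofFn π) ?_ ?_ ?_
  · intro π hπ
    rw [Finset.mem_filter] at hπ
    rw [Finset.mem_filter, mem_orderings, ← valleysEvenPeaksOdd_iff]
    refine ⟨⟨List.nodup_ofFn.2 π.injective, ?_⟩, hπ.2⟩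
    ext x
    simp only [List.mem_toFinset, List.mem_ofFn, Finset.mem_univ, iff_true]
    exact π.surjective x
  · intro π _ π' _ h
    exact Equiv.ext fun x => congrFun (List.ofFn_injective h) x
  · intro l hl
    rw [Finset.mem_filter, mem_orderings] at hl
    obtain ⟨⟨hn, hl'⟩, hA⟩ := hl
    have hlen : l.length = n := by
      rw [← List.toFinset_card_of_nodup hn, hl', Finset.card_univ, Fintype.card_fin]
    have hinj : Function.Injective fun i : Fin n => l.get (i.cast hlen.symm) :=
      (List.nodup_iff_injective_get.1 hn).comp (Fin.cast_injective _)
    have hofn : List.ofFn (Equiv.ofBijective _ (Finite.injective_iff_bijective.1 hinj)) = l := by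
      apply List.ext_getElem <;> simp [hlen]
    exact ⟨_, by rw [Finset.mem_filter, valleysEvenPeaksOdd_iff, hofn]; simpa using hA, hofn⟩

theorem f_le_factorial (n : ℕ) : f n ≤ n.factorial := by
  classical
  rw [f, ← Fintype.card_fin n, ← Fintype.card_perm, Fintype.card_fin, ← Nat.card_eq_fintype_card]
  exact Finite.card_subtype_le _

end Permutations

/-! ### The generating function as a formal power series -/

section Formal

open PowerSeries

/-- The power series of `exp (a z)`. -/
noncomputable def expSeries (a : ℂ) : ℂ⟦X⟧ := mk fun n => a ^ n / n.factorial

theorem expSeries_mul (a b : ℂ) : expSeries a * expSeries b = expSeries (a + b) := by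
  have h : ∀ c, expSeries c = rescale c (exp ℂ) := by
    intro c; ext n; simp [expSeries, coeff_exp, div_eq_mul_inv]
  rw [h, h, h, exp_mul_exp_eq_exp_add]

theorem expSeries_zero : expSeries 0 = 1 := by
  ext n; rcases n with _ | n <;> simp [expSeries]

theorem expSeries_mul_neg (a : ℂ) : expSeries a * expSeries (-a) = 1 := by
  rw [expSeries_mul, add_neg_cancel, expSeries_zero]

theorem rescale_expSeries (a : ℂ) : rescale (-1) (expSeries a) = expSeries (-a) := by
  ext n; simp [expSeries, neg_pow a]; ring

theorem derivative_expSeries (a : ℂ) : d⁄dX ℂ (expSeries a) = C a * expSeries a := by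
  ext n
  rw [coeff_derivative, coeff_C_mul]
  simp only [expSeries, coeff_mk, Nat.factorial_succ]
  have : (n.factorial : ℂ) ≠ 0 := by exact_mod_cast n.factorial_ne_zero
  have : (n : ℂ) + 1 ≠ 0 := by exact_mod_cast n.succ_ne_zero
  push_cast
  field_simp
  ring

/-- The Taylor series of `D` at `0`. -/
noncomputable def DSeries : ℂ⟦X⟧ :=
  C (3 / 2) * (expSeries (Complex.I / 2) + expSeries (-(Complex.I / 2))) -
    C (((√3 : ℝ) : ℂ) / 2) * (expSeries ((√3 : ℝ) / 2) - expSeries (-((√3 : ℝ) / 2)))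

theorem sqrt_three_sq : ((√3 : ℝ) : ℂ) ^ 2 = 3 := by
  norm_cast; simp

theorem derivative_DSeries : d⁄dX ℂ DSeries =
    C (3 * Complex.I / 4) * (expSeries (Complex.I / 2) - expSeries (-(Complex.I / 2))) -
    C (3 / 4) * (expSeries ((√3 : ℝ) / 2) + expSeries (-((√3 : ℝ) / 2))) := by
  have h3 := sqrt_three_sq
  have e1 : C (3 / 2 : ℂ) * C (Complex.I / 2) = C (3 * Complex.I / 4) := by
    rw [← map_mul]; congr 1; ring
  have e2 : C (((√3 : ℝ) : ℂ) / 2) * C (((√3 : ℝ) : ℂ) / 2) = C (3 / 4) := by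
    rw [← map_mul]; congr 1; linear_combination h3 / 4
  simp only [DSeries, map_sub, map_add, Derivation.leibniz, derivative_expSeries, derivative_C,
    smul_eq_mul, map_neg, ← e1, ← e2]
  ring

theorem derivative_derivative_DSeries : d⁄dX ℂ (d⁄dX ℂ DSeries) =
    -C (3 / 8) * (expSeries (Complex.I / 2) + expSeries (-(Complex.I / 2))) -
    C (3 * ((√3 : ℝ) : ℂ) / 8) * (expSeries ((√3 : ℝ) / 2) - expSeries (-((√3 : ℝ) / 2))) := by
  have e1 : C (3 * Complex.I / 4 : ℂ) * C (Complex.I / 2) = -C (3 / 8) := by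
    rw [← map_mul, ← map_neg]; congr 1; linear_combination 3 / 8 * Complex.I_sq
  have e2 : C (3 / 4 : ℂ) * C (((√3 : ℝ) : ℂ) / 2) = C (3 * ((√3 : ℝ) : ℂ) / 8) := by
    rw [← map_mul]; congr 1; ring
  rw [derivative_DSeries]
  simp only [map_sub, map_add, Derivation.leibniz, derivative_expSeries, derivative_C,
    smul_eq_mul, map_neg, ← e1, ← e2]
  ring

theorem rescale_C (a b : ℂ) : rescale a (C b) = C b := by
  ext n; rcases n with _ | n <;> simp [coeff_C]

theorem derivative_rescale_neg_one (p : ℂ⟦X⟧) :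
    d⁄dX ℂ (rescale (-1) p) = -rescale (-1) (d⁄dX ℂ p) := by
  ext n; simp [coeff_derivative, pow_succ]; ring

/-- The differential relation between `D` and `z ↦ D (-z)` behind the generating function. -/
theorem DSeries_relation :
    -4 * d⁄dX ℂ (d⁄dX ℂ DSeries) * rescale (-1) DSeries =
      4 * (d⁄dX ℂ DSeries * rescale (-1) (d⁄dX ℂ DSeries)) +
        (rescale (-1) DSeries ^ 2 - DSeries ^ 2) := by
  rw [derivative_derivative_DSeries, derivative_DSeries]
  simp only [DSeries, map_sub, map_add, map_mul, rescale_C, rescale_expSeries, neg_neg]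
  have hp := expSeries_mul_neg (Complex.I / 2)
  have hq := expSeries_mul_neg (((√3 : ℝ) : ℂ) / 2)
  set p := expSeries (Complex.I / 2)
  set p' := expSeries (-(Complex.I / 2))
  set q := expSeries (((√3 : ℝ) : ℂ) / 2)
  set q' := expSeries (-(((√3 : ℝ) : ℂ) / 2))
  have c1 : C (3 / 8 : ℂ) = 3 * C (1 / 8 : ℂ) := by
    rw [← map_ofNat C 3, ← map_mul]; congr 1; norm_num
  have c2 : C (3 * ((√3 : ℝ) : ℂ) / 8) = 3 * C ((√3 : ℝ) : ℂ) * C (1 / 8 : ℂ) := by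
    rw [← map_ofNat C 3, ← map_mul, ← map_mul]; congr 1; ring
  have c3 : C (3 / 2 : ℂ) = 12 * C (1 / 8 : ℂ) := by
    rw [← map_ofNat C 12, ← map_mul]; congr 1; norm_num
  have c4 : C (((√3 : ℝ) : ℂ) / 2) = 4 * C ((√3 : ℝ) : ℂ) * C (1 / 8 : ℂ) := by
    rw [← map_ofNat C 4, ← map_mul, ← map_mul]; congr 1; ring
  have c5 : C (3 * Complex.I / 4) = 6 * C Complex.I * C (1 / 8 : ℂ) := by
    rw [← map_ofNat C 6, ← map_mul, ← map_mul]; congr 1; ring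
  have c6 : C (3 / 4 : ℂ) = 6 * C (1 / 8 : ℂ) := by
    rw [← map_ofNat C 6, ← map_mul]; congr 1; norm_num
  have ht : C ((√3 : ℝ) : ℂ) ^ 2 = (3 : ℂ⟦X⟧) := by
    rw [← map_pow, sqrt_three_sq]; exact map_ofNat C 3
  have hi : C Complex.I ^ 2 = (-1 : ℂ⟦X⟧) := by
    rw [← map_pow, Complex.I_sq, map_neg, map_one]
  rw [c1, c2, c3, c4, c5, c6]
  set t := C ((√3 : ℝ) : ℂ)
  set i := C Complex.I
  set e := C (1 / 8 : ℂ)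
  linear_combination 48 * e ^ 2 * (q - q') ^ 2 * ht + 576 * e ^ 2 * hp - 576 * e ^ 2 * hq +
    144 * e ^ 2 * (p - p') ^ 2 * hi

/-- The even part of a power series. -/
noncomputable def evenPart (p : ℂ⟦X⟧) : ℂ⟦X⟧ := mk fun n => if Even n then coeff n p else 0

/-- The odd part of a power series. -/
noncomputable def oddPart (p : ℂ⟦X⟧) : ℂ⟦X⟧ := mk fun n => if Even n then 0 else coeff n p

theorem two_mul_evenPart (p : ℂ⟦X⟧) : 2 * evenPart p = p + rescale (-1) p := by
  ext n
  rw [← map_ofNat C 2, coeff_C_mul]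
  by_cases h : Even n
  · simp [evenPart, h]; ring
  · simp [evenPart, h, Nat.not_even_iff_odd.1 h]

theorem two_mul_oddPart (p : ℂ⟦X⟧) : 2 * oddPart p = p - rescale (-1) p := by
  ext n
  rw [← map_ofNat C 2, coeff_C_mul]
  by_cases h : Even n
  · simp [oddPart, h]
  · simp [oddPart, h, Nat.not_even_iff_odd.1 h]; ring

/-- The differential system satisfied by the two exponential generating functions. -/
structure IsSolution (F A : ℂ⟦X⟧) : Prop where
  constF : coeff 0 F = 1
  constA : coeff 0 A = 1
  derivF : d⁄dX ℂ F = evenPart F * F + oddPart A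
  derivA : d⁄dX ℂ A = evenPart F * A

/-- The system is a recurrence for the coefficients, so its solution is unique. -/
theorem IsSolution.ext {F A F' A' : ℂ⟦X⟧} (h : IsSolution F A) (h' : IsSolution F' A') :
    F = F' := by
  have key : ∀ n, coeff n F = coeff n F' ∧ coeff n A = coeff n A' := by
    intro n
    induction n using Nat.strong_induction_on with
    | _ n ih =>
      rcases n with _ | n
      · exact ⟨h.constF.trans h'.constF.symm, h.constA.trans h'.constA.symm⟩
      · have hne : (n : ℂ) + 1 ≠ 0 := by exact_mod_cast n.succ_ne_zero
        have hmul : ∀ G G' : ℂ⟦X⟧, (∀ k ≤ n, coeff k G = coeff k G') →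
            coeff n (evenPart F * G) = coeff n (evenPart F' * G') := by
          intro G G' hG
          rw [coeff_mul, coeff_mul]
          refine Finset.sum_congr rfl fun x hx => ?_
          rw [Finset.HasAntidiagonal.mem_antidiagonal] at hx
          simp only [evenPart, coeff_mk]
          rw [(ih x.1 (by omega)).1, hG x.2 (by omega)]
        constructor
        · apply mul_right_cancel₀ hne
          rw [← coeff_derivative, ← coeff_derivative, h.derivF, h'.derivF, map_add, map_add,
            hmul F F' fun k hk => (ih k (by omega)).1]
          simp only [oddPart, coeff_mk]
          rw [(ih n (by omega)).2]
        · apply mul_right_cancel₀ hne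
          rw [← coeff_derivative, ← coeff_derivative, h.derivA, h'.derivA,
            hmul A A' fun k hk => (ih k (by omega)).2]
  ext n
  exact (key n).1

/-- The exponential generating function of `altCount e`. -/
noncomputable def altSeries (e : Bool) : ℂ⟦X⟧ := mk fun n => (altCount e n : ℂ) / n.factorial

theorem derivative_altSeries (e : Bool) : d⁄dX ℂ (altSeries e) =
    evenPart (altSeries false) * altSeries e + if e = false then oddPart (altSeries true) else 0 := by
  ext n
  have hn : (n.factorial : ℂ) ≠ 0 := by exact_mod_cast n.factorial_ne_zero
  have hn1 : (n : ℂ) + 1 ≠ 0 := by exact_mod_cast n.succ_ne_zero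
  have h1 : coeff n (d⁄dX ℂ (altSeries e)) = (altCount e (n + 1) : ℂ) / n.factorial := by
    rw [coeff_derivative, altSeries, coeff_mk, Nat.factorial_succ]
    push_cast
    field_simp
  have h2 : coeff n (if e = false then oddPart (altSeries true) else 0) =
      ((if e = false ∧ ¬ Even n then altCount true n else 0 : ℕ) : ℂ) / n.factorial := by
    by_cases he : e = false <;> by_cases hev : Even n <;> simp [he, hev, oddPart, altSeries]
  rw [h1, map_add, h2, altCount_succ, Nat.cast_add, add_div, coeff_mul,
    Finset.Nat.sum_antidiagonal_eq_sum_range_succ_mk, Nat.cast_sum, Finset.sum_div]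
  congr 1
  refine Finset.sum_congr rfl fun k hk => ?_
  have hk : k ≤ n := by simpa [Nat.lt_succ_iff] using hk
  by_cases hev : Even k
  · have a1 : (k.factorial : ℂ) ≠ 0 := by exact_mod_cast k.factorial_ne_zero
    have a2 : ((n - k).factorial : ℂ) ≠ 0 := by exact_mod_cast (n - k).factorial_ne_zero
    simp only [hev, evenPart, altSeries, coeff_mk, if_true]
    push_cast
    rw [Nat.cast_choose ℂ hk]
    field_simp
  · simp [hev, evenPart]

theorem isSolution_altSeries : IsSolution (altSeries false) (altSeries true) where
  constF := by simp [altSeries, altCount_zero]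
  constA := by simp [altSeries, altCount_zero]
  derivF := by simpa using derivative_altSeries false
  derivA := by simpa using derivative_altSeries true

theorem constantCoeff_DSeries : constantCoeff DSeries = 3 := by
  rw [← coeff_zero_eq_constantCoeff_apply]
  simp [DSeries, expSeries]
  norm_num

theorem constantCoeff_derivative_DSeries : constantCoeff (d⁄dX ℂ DSeries) = -(3 / 2) := by
  rw [derivative_DSeries, ← coeff_zero_eq_constantCoeff_apply]
  simp [expSeries]
  norm_num

theorem isSolution_DSeries :
    IsSolution (-2 * d⁄dX ℂ DSeries * DSeries⁻¹) (rescale (-1) DSeries * DSeries⁻¹) := by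
  have hI : DSeries * DSeries⁻¹ = 1 := PowerSeries.mul_inv_cancel _ (by
    rw [constantCoeff_DSeries]; norm_num)
  have hJ : rescale (-1) DSeries * rescale (-1) DSeries⁻¹ = 1 := by
    rw [← map_mul, hI, map_one]
  have hdI := derivative_inv' DSeries
  have hrel := DSeries_relation
  have hdm := derivative_rescale_neg_one DSeries
  have two_cancel : ∀ {a b : ℂ⟦X⟧}, 2 * a = 2 * b → a = b := fun {a b} h => by
    have h2 : C (1 / 2 : ℂ) * 2 = 1 := by rw [← map_ofNat C 2, ← map_mul]; simp
    linear_combination C (1 / 2 : ℂ) * h + (b - a) * h2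
  have hd2 : d⁄dX ℂ (2 : ℂ⟦X⟧) = 0 := by rw [← map_ofNat C 2, derivative_C]
  have hr2 : rescale (-1 : ℂ) (2 : ℂ⟦X⟧) = 2 := map_ofNat _ 2
  have hrr : rescale (-1 : ℂ) (rescale (-1) DSeries) = DSeries := by
    rw [rescale_rescale]; simp
  have he : ∀ G : ℂ⟦X⟧, 2 * (evenPart (-2 * d⁄dX ℂ DSeries * DSeries⁻¹) * G) =
      (-2 * d⁄dX ℂ DSeries * DSeries⁻¹ +
      -2 * rescale (-1) (d⁄dX ℂ DSeries) * rescale (-1) DSeries⁻¹) * G := by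
    intro G
    rw [← mul_assoc, two_mul_evenPart, map_mul, map_mul, map_neg, hr2]
  refine ⟨?_, ?_, ?_, ?_⟩
  · rw [coeff_zero_eq_constantCoeff_apply, map_mul, map_mul, constantCoeff_inv,
      constantCoeff_DSeries, constantCoeff_derivative_DSeries, map_neg, map_ofNat]
    norm_num
  · rw [coeff_zero_eq_constantCoeff_apply, map_mul, constantCoeff_inv, constantCoeff_DSeries,
      ← coeff_zero_eq_constantCoeff_apply, coeff_rescale, coeff_zero_eq_constantCoeff_apply,
      constantCoeff_DSeries]
    norm_num
  · apply two_cancel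
    rw [mul_add, two_mul_oddPart, he]
    simp only [Derivation.leibniz, hdI, smul_eq_mul, map_neg, hd2, map_mul, hrr]
    generalize d⁄dX ℂ (d⁄dX ℂ DSeries) = D2 at *
    generalize d⁄dX ℂ DSeries = D1 at *
    generalize DSeries⁻¹ = I at *
    generalize rescale (-1) I = J at *
    generalize rescale (-1) D1 = D1m at *
    generalize rescale (-1) DSeries = Dm at *
    generalize DSeries = D at *
    linear_combination I * J * hrel + (4 * D2 * I + Dm * I) * hJ - D * J * hI
  · apply two_cancel
    rw [he]
    simp only [Derivation.leibniz, hdI, hdm, smul_eq_mul]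
    generalize d⁄dX ℂ DSeries = D1 at *
    generalize DSeries⁻¹ = I at *
    generalize rescale (-1) I = J at *
    generalize rescale (-1) D1 = D1m at *
    generalize rescale (-1) DSeries = Dm at *
    linear_combination 2 * D1m * I * hJ

/-- The exponential generating function of `f` is the logarithmic derivative `-2 derivD / D`. -/
theorem altSeries_mul_DSeries : altSeries false * DSeries = -2 * d⁄dX ℂ DSeries := by
  have hI : DSeries⁻¹ * DSeries = 1 := PowerSeries.inv_mul_cancel _ (by
    rw [constantCoeff_DSeries]; norm_num)
  rw [isSolution_altSeries.ext isSolution_DSeries, mul_assoc, hI, mul_one]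

end Formal

/-! ### Convergence of the generating function -/

section Evaluation

open PowerSeries

/-- The derivative of the entire function `D`. -/
noncomputable def derivD (z : ℂ) : ℂ :=
  -(3 / 2) * (Complex.sin (z / 2) + Complex.cosh ((Real.sqrt 3 : ℂ) * z / 2))

theorem hasDerivAt_D (z : ℂ) : HasDerivAt D (derivD z) z := by
  have h1 : HasDerivAt (fun z : ℂ => z / 2) (1 / 2) z := (hasDerivAt_id z).div_const 2
  have h2 : HasDerivAt (fun z : ℂ => (Real.sqrt 3 : ℂ) * z / 2) ((Real.sqrt 3 : ℂ) * 1 / 2) z :=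
    ((hasDerivAt_id z).const_mul _).div_const 2
  refine ((h1.ccos.const_mul 3).sub (h2.csinh.const_mul (Real.sqrt 3 : ℂ))).congr_deriv ?_
  have := sqrt_three_sq
  rw [derivD]
  linear_combination (-(1 / 2) * Complex.cosh ((Real.sqrt 3 : ℂ) * z / 2)) * this

theorem hasSum_expSeries (a z : ℂ) :
    HasSum (fun n => coeff n (expSeries a) * z ^ n) (Complex.exp (a * z)) := by
  have h := NormedSpace.expSeries_div_hasSum_exp (a * z)
  rw [← Complex.exp_eq_exp_ℂ] at h
  refine h.congr_fun fun n => ?_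
  rw [expSeries, coeff_mk, mul_pow]
  ring

theorem hasSum_DSeries (z : ℂ) : HasSum (fun n => coeff n DSeries * z ^ n) (D z) := by
  have h := (((hasSum_expSeries (Complex.I / 2) z).add
    (hasSum_expSeries (-(Complex.I / 2)) z)).mul_left (3 / 2)).sub
    (((hasSum_expSeries (((√3 : ℝ) : ℂ) / 2) z).sub
    (hasSum_expSeries (-(((√3 : ℝ) : ℂ) / 2)) z)).mul_left (((√3 : ℝ) : ℂ) / 2))
  have e : D z = 3 / 2 * (Complex.exp (Complex.I / 2 * z) + Complex.exp (-(Complex.I / 2) * z)) -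
      ((√3 : ℝ) : ℂ) / 2 * (Complex.exp (((√3 : ℝ) : ℂ) / 2 * z) -
        Complex.exp (-(((√3 : ℝ) : ℂ) / 2) * z)) := by
    simp only [D, Complex.cos, Complex.sinh]
    ring_nf
  rw [e]
  refine h.congr_fun fun n => ?_
  simp only [DSeries, map_sub, map_add, coeff_C_mul]
  ring

theorem hasSum_derivative_DSeries (z : ℂ) :
    HasSum (fun n => coeff n (d⁄dX ℂ DSeries) * z ^ n) (derivD z) := by
  have h := (((hasSum_expSeries (Complex.I / 2) z).sub
    (hasSum_expSeries (-(Complex.I / 2)) z)).mul_left (3 * Complex.I / 4)).sub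
    (((hasSum_expSeries (((√3 : ℝ) : ℂ) / 2) z).add
    (hasSum_expSeries (-(((√3 : ℝ) : ℂ) / 2)) z)).mul_left (3 / 4))
  have e : derivD z =
      3 * Complex.I / 4 * (Complex.exp (Complex.I / 2 * z) - Complex.exp (-(Complex.I / 2) * z)) -
      3 / 4 * (Complex.exp (((√3 : ℝ) : ℂ) / 2 * z) +
        Complex.exp (-(((√3 : ℝ) : ℂ) / 2) * z)) := by
    simp only [derivD, Complex.sin, Complex.cosh]
    ring_nf
  rw [e]
  refine h.congr_fun fun n => ?_
  simp only [derivative_DSeries, map_sub, map_add, coeff_C_mul]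
  ring

/-- As `f n ≤ n!`, the generating function converges in the open unit disc. -/
theorem norm_coeff_altSeries_le (n : ℕ) : ‖coeff n (altSeries false)‖ ≤ 1 := by
  rw [altSeries, coeff_mk, ← f_eq_altCount, norm_div, Complex.norm_natCast, Complex.norm_natCast]
  exact div_le_one_of_le₀ (by exact_mod_cast f_le_factorial n) (by positivity)

theorem summable_norm_altSeries {z : ℂ} (hz : ‖z‖ < 1) :
    Summable fun n => ‖coeff n (altSeries false) * z ^ n‖ := by
  refine Summable.of_nonneg_of_le (fun n => norm_nonneg _) (fun n => ?_)
    (summable_geometric_of_lt_one (norm_nonneg z) hz)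
  rw [norm_mul, norm_pow]
  exact mul_le_of_le_one_left (by positivity) (norm_coeff_altSeries_le n)

theorem tsum_altSeries_mul_D {z : ℂ} (hz : ‖z‖ < 1) :
    (∑' n, coeff n (altSeries false) * z ^ n) * D z = -2 * derivD z := by
  have hD := hasSum_DSeries z
  rw [← hD.tsum_eq, tsum_mul_tsum_eq_tsum_sum_antidiagonal_of_summable_norm
    (summable_norm_altSeries hz) hD.summable.norm,
    ← ((hasSum_derivative_DSeries z).mul_left (-2)).tsum_eq]
  refine tsum_congr fun n => ?_
  have h := congrArg (coeff n) altSeries_mul_DSeries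
  have h2 : (-2 : ℂ⟦X⟧) = C (-2) := by rw [map_neg, map_ofNat]
  rw [coeff_mul, h2, coeff_C_mul] at h
  rw [← mul_assoc, ← h, Finset.sum_mul]
  refine Finset.sum_congr rfl fun x hx => ?_
  rw [Finset.HasAntidiagonal.mem_antidiagonal] at hx
  rw [← hx, pow_add]
  ring

end Evaluation

/-! ### Zeros of `D` in the disc of radius `3.28` -/

section Zeros

open Real

theorem sqrt_three_sq_real : √3 ^ 2 = 3 := Real.sq_sqrt (by norm_num)

theorem sqrt_three_bounds : 1.732 < √3 ∧ √3 < 1.733 :=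
  ⟨Real.lt_sqrt_of_sq_lt (by norm_num), (Real.sqrt_lt' (by norm_num)).2 (by norm_num)⟩

theorem D_re (x y : ℝ) : (D ⟨x, y⟩).re =
    3 * (cos (x / 2) * cosh (y / 2)) - √3 * (sinh (√3 * x / 2) * cos (√3 * y / 2)) := by
  have e1 : (⟨x, y⟩ : ℂ) / 2 = ((x / 2 : ℝ) : ℂ) + ((y / 2 : ℝ) : ℂ) * Complex.I := by
    apply Complex.ext <;> simp
  have e2 : (√3 : ℂ) * ⟨x, y⟩ / 2 =
      ((√3 * x / 2 : ℝ) : ℂ) + ((√3 * y / 2 : ℝ) : ℂ) * Complex.I := by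
    apply Complex.ext <;> simp
  rw [D, e1, e2, Complex.cos_add_mul_I, Complex.sinh_add, Complex.sinh_mul_I, Complex.cosh_mul_I]
  norm_cast
  simp [-Complex.ofReal_cos, -Complex.ofReal_sin, -Complex.ofReal_sinh, -Complex.ofReal_cosh]

theorem D_im (x y : ℝ) : (D ⟨x, y⟩).im =
    -(3 * (sin (x / 2) * sinh (y / 2))) - √3 * (cosh (√3 * x / 2) * sin (√3 * y / 2)) := by
  have e1 : (⟨x, y⟩ : ℂ) / 2 = ((x / 2 : ℝ) : ℂ) + ((y / 2 : ℝ) : ℂ) * Complex.I := by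
    apply Complex.ext <;> simp
  have e2 : (√3 : ℂ) * ⟨x, y⟩ / 2 =
      ((√3 * x / 2 : ℝ) : ℂ) + ((√3 * y / 2 : ℝ) : ℂ) * Complex.I := by
    apply Complex.ext <;> simp
  rw [D, e1, e2, Complex.cos_add_mul_I, Complex.sinh_add, Complex.sinh_mul_I, Complex.cosh_mul_I]
  norm_cast
  simp [-Complex.ofReal_cos, -Complex.ofReal_sin, -Complex.ofReal_sinh, -Complex.ofReal_cosh]

theorem D_conj (z : ℂ) : D (starRingEnd ℂ z) = starRingEnd ℂ (D z) := by
  simp only [D, map_sub, map_mul, ← Complex.cos_conj, ← Complex.sinh_conj, map_div₀,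
    Complex.conj_ofReal, map_ofNat]

theorem one_add_sq_div_two_le_cosh (x : ℝ) : 1 + x ^ 2 / 2 ≤ cosh x := by
  have h := Real.cosh_two_mul (x / 2)
  have h1 := Real.cosh_sq (x / 2)
  rw [mul_div_cancel₀ x two_ne_zero] at h
  have h2 : (x / 2) ^ 2 ≤ sinh (x / 2) ^ 2 := by
    apply sq_le_sq.2
    rcases le_total 0 (x / 2) with h0 | h0
    · rw [abs_of_nonneg h0, abs_of_nonneg (Real.sinh_nonneg_iff.2 h0)]
      exact Real.self_le_sinh_iff.2 h0
    · rw [abs_of_nonpos h0, abs_of_nonpos (Real.sinh_nonpos_iff.2 h0)]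
      exact neg_le_neg (Real.sinh_le_self_iff.2 h0)
  nlinarith

/-- Taking squared moduli of the two terms of `D` at a zero separates the variables. -/
theorem modulus_relation {s y : ℝ} (h : D ⟨-s, y⟩ = 0) :
    3 * cosh y + cos (√3 * y) = cosh (√3 * s) - 3 * cos s := by
  have hre := D_re (-s) y
  have him := D_im (-s) y
  rw [h] at hre him
  simp only [Complex.zero_re, Complex.zero_im, neg_div, mul_neg, Real.cos_neg, Real.sin_neg,
    Real.sinh_neg, Real.cosh_neg] at hre him
  have e1 := Real.cosh_two_mul (y / 2)
  have e2 := Real.cos_two_mul (√3 * y / 2)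
  have e3 := Real.cosh_two_mul (√3 * s / 2)
  have e4 := Real.cos_two_mul (s / 2)
  rw [mul_div_cancel₀ _ two_ne_zero] at e1 e2 e3 e4
  rw [e1, e2, e3, e4]
  have f1 := Real.cosh_sq (y / 2)
  have f2 := Real.sin_sq_add_cos_sq (√3 * y / 2)
  have f3 := Real.cosh_sq (√3 * s / 2)
  have f4 := Real.sin_sq_add_cos_sq (s / 2)
  have h3 := sqrt_three_sq_real
  generalize cosh (y / 2) = a at *
  generalize sinh (y / 2) = b at *
  generalize cos (√3 * y / 2) = c at *
  generalize sin (√3 * y / 2) = d at *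
  generalize cosh (√3 * s / 2) = p at *
  generalize sinh (√3 * s / 2) = q at *
  generalize cos (s / 2) = u at *
  generalize sin (s / 2) = v at *
  have g1 : 9 * (u * a) ^ 2 = 3 * (q * c) ^ 2 := by
    have : 3 * (u * a) = -(√3 * (q * c)) := by linarith
    calc 9 * (u * a) ^ 2 = (3 * (u * a)) ^ 2 := by ring
      _ = √3 ^ 2 * (q * c) ^ 2 := by rw [this]; ring
      _ = _ := by rw [h3]
  have g2 : 9 * (v * b) ^ 2 = 3 * (p * d) ^ 2 := by
    have : 3 * (v * b) = (√3 * (p * d)) := by linarith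
    calc 9 * (v * b) ^ 2 = (3 * (v * b)) ^ 2 := by ring
      _ = √3 ^ 2 * (p * d) ^ 2 := by rw [this]; ring
      _ = _ := by rw [h3]
  have k1 : b ^ 2 = a ^ 2 - 1 := by linarith
  have k2 : d ^ 2 = 1 - c ^ 2 := by linarith
  have k3 : p ^ 2 = q ^ 2 + 1 := f3
  have k4 : v ^ 2 = 1 - u ^ 2 := by linarith
  rw [mul_pow, mul_pow, k1, k2, k3, k4] at g2
  rw [mul_pow, mul_pow] at g1
  rw [k1, k3]
  linarith

/-- The left side of `modulus_relation` increases: `3 sinh y > 3 y ≥ √3 sin (√3 y)` for `y > 0`. -/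
theorem strictMonoOn_three_cosh_add_cos :
    StrictMonoOn (fun y => 3 * cosh y + cos (√3 * y)) (Set.Ici 0) := by
  refine strictMonoOn_of_deriv_pos (convex_Ici 0) (by fun_prop) fun y hy => ?_
  rw [interior_Ici, Set.mem_Ioi] at hy
  have hd : HasDerivAt (fun y => 3 * cosh y + cos (√3 * y))
      (3 * sinh y + -sin (√3 * y) * (√3 * 1)) y :=
    ((Real.hasDerivAt_cosh y).const_mul 3).add ((hasDerivAt_id y).const_mul (√3)).cos
  rw [hd.deriv]
  have h1 : y < sinh y := Real.self_lt_sinh_iff.2 hy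
  have h0 : 0 < √3 := by positivity
  have h2 : sin (√3 * y) < √3 * y := Real.sin_lt (by positivity)
  have h3 := sqrt_three_sq_real
  nlinarith

theorem strictMonoOn_cosh_sub_three_cos :
    StrictMonoOn (fun s => cosh (√3 * s) - 3 * cos s) (Set.Icc 0 π) := by
  intro s hs t ht hst
  have h1 : cos t < cos s := Real.strictAntiOn_cos hs ht hst
  have h2 : cosh (√3 * s) < cosh (√3 * t) := by
    have h0 : 0 < √3 := by positivity
    have := hs.1
    rw [Real.cosh_lt_cosh, abs_of_nonneg (by positivity), abs_of_nonneg (by nlinarith)]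
    nlinarith
  simp only
  linarith

/-- The numerator of the derivative is at least `cosh (y / 2) * sin (√3 y / 2 + π / 6)` where
`cos (√3 y / 2) < 0`, which is the reason for the upper end of the interval. -/
theorem strictMonoOn_neg_cos_div_cosh :
    StrictMonoOn (fun y => -cos (√3 * y / 2) / cosh (y / 2))
      (Set.Icc (π / √3) (5 * π / (3 * √3))) := by
  have h0 : 0 < √3 := by positivity
  refine strictMonoOn_of_deriv_pos (convex_Icc _ _)
    (ContinuousOn.div (by fun_prop) (by fun_prop) fun y _ => (Real.cosh_pos _).ne') fun y hy => ?_
  rw [interior_Icc, Set.mem_Ioo, div_lt_iff₀ h0, lt_div_iff₀ (by positivity)] at hy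
  have hc := Real.cosh_pos (y / 2)
  have hd : HasDerivAt (fun y => -cos (√3 * y / 2) / cosh (y / 2))
      ((-(-sin (√3 * y / 2) * (√3 * 1 / 2)) * cosh (y / 2) -
        -cos (√3 * y / 2) * (sinh (y / 2) * (1 / 2))) / cosh (y / 2) ^ 2) y :=
    (((hasDerivAt_id y).const_mul (√3)).div_const 2).cos.neg.div
      ((hasDerivAt_id y).div_const 2).cosh hc.ne'
  rw [hd.deriv]
  refine div_pos ?_ (by positivity)
  have hpi := Real.pi_pos
  have hcos : cos (√3 * y / 2) < 0 :=
    Real.cos_neg_of_pi_div_two_lt_of_lt (by nlinarith) (by nlinarith)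
  have hsin : 0 < sin (√3 * y / 2 + π / 6) :=
    Real.sin_pos_of_pos_of_lt_pi (by nlinarith) (by nlinarith)
  rw [Real.sin_add, Real.cos_pi_div_six, Real.sin_pi_div_six] at hsin
  have hs := Real.sinh_lt_cosh (y / 2)
  nlinarith [mul_pos hsin hc]

/-- A zero of `D` in the open upper half plane of modulus at most `3.28` has its real part in
`(-π, 0)` and its imaginary part where `strictMonoOn_neg_cos_div_cosh` applies. -/
theorem upper_zero_bounds {s y : ℝ} (h : D ⟨-s, y⟩ = 0) (hy : 0 < y)
    (hR : s ^ 2 + y ^ 2 ≤ 3.28 ^ 2) :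
    (0 < s ∧ s < π) ∧ (π / √3 < y ∧ y < 5 * π / (3 * √3)) := by
  have h0 : 0 < √3 := by positivity
  obtain ⟨hl, hu⟩ := sqrt_three_bounds
  have hpi := Real.pi_gt_d4
  have hpi' := Real.pi_lt_d4
  have hU := modulus_relation h
  have hre := D_re (-s) y
  have him := D_im (-s) y
  rw [h] at hre him
  simp only [Complex.zero_re, Complex.zero_im, neg_div, mul_neg, Real.cos_neg, Real.sin_neg,
    Real.sinh_neg, Real.cosh_neg] at hre him
  have hy1 : y ≤ 3.28 := by nlinarith
  have hs1 : s ≤ 3.28 := by nlinarith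
  have hs2 : -3.28 ≤ s := by nlinarith
  have hsin : 0 < sin (√3 * y / 2) := Real.sin_pos_of_pos_of_lt_pi (by positivity) (by nlinarith)
  have hch := Real.cosh_pos (√3 * s / 2)
  have hsh : 0 < sinh (y / 2) := Real.sinh_pos_iff.2 (by positivity)
  -- The imaginary part of `D` vanishes, so `sin (s / 2)` and `sin (√3 y / 2)` have the same sign.
  have hs : 0 < s := by
    by_contra hneg
    have : sin (s / 2) ≤ 0 := Real.sin_nonpos_of_nonpos_of_neg_pi_le (by linarith) (by linarith)
    have h2 := mul_pos h0 (mul_pos hch hsin)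
    nlinarith
  have hspi : s < π := by
    -- Otherwise `y ≤ 1`, and the right side of `modulus_relation` is too large.
    by_contra hge
    push Not at hge
    have hy2 : y ^ 2 ≤ 1 := by nlinarith
    have h1 : cosh y ≤ 1.65 := by
      refine (Real.cosh_le_exp_half_sq y).trans ((Real.exp_le_exp.2 (by linarith :
        y ^ 2 / 2 ≤ 1 / 2)).trans ?_)
      have he : exp (1 / 2) ^ 2 = exp 1 := by rw [← Real.exp_nat_mul]; norm_num
      have := Real.exp_one_lt_d9
      exact abs_le_of_sq_le_sq' (by rw [he]; norm_num; linarith) (by norm_num) |>.2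
    have h2 := one_add_sq_div_two_le_cosh (√3 * s)
    rw [mul_pow, sqrt_three_sq_real] at h2
    have h3 := Real.cos_le_one (√3 * y)
    have h4 := Real.cos_le_one s
    nlinarith
  have hcs : 0 < cos (s / 2) := Real.cos_pos_of_mem_Ioo ⟨by linarith, by linarith⟩
  have hshs : 0 < sinh (√3 * s / 2) := Real.sinh_pos_iff.2 (by positivity)
  have hylow : π / √3 < y := by
    rw [div_lt_iff₀ h0]
    by_contra hge
    have : 0 ≤ cos (√3 * y / 2) :=
      Real.cos_nonneg_of_mem_Icc ⟨by nlinarith, by linarith⟩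
    have h2 := mul_pos hcs (Real.cosh_pos (y / 2))
    have h3 := mul_nonneg h0.le (mul_nonneg hshs.le this)
    linarith
  have hs13 : 1.3 < s := by
    -- For `s ≤ 1.3`, the left side of `modulus_relation` exceeds `6.9` and the right one is at
    -- most `6.44`.
    by_contra hle
    push Not at hle
    have hy3 : 1.81 < y := by
      rw [div_lt_iff₀ h0] at hylow
      nlinarith
    have h1 := one_add_sq_div_two_le_cosh y
    have h2 := Real.neg_one_le_cos (√3 * y)
    have h3 : 0 ≤ cos s := Real.cos_nonneg_of_mem_Icc ⟨by linarith, by linarith⟩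
    have h4 : cosh (√3 * s) ≤ 6.44 := by
      have e := Real.cosh_two_mul (√3 * s / 2)
      rw [mul_div_cancel₀ _ two_ne_zero, Real.sinh_sq] at e
      have e1 : cosh (√3 * s / 2) ^ 2 ≤ exp 1 * exp 0.2675 := by
        refine (pow_le_pow_left₀ hch.le (Real.cosh_le_exp_half_sq _) 2).trans ?_
        rw [← Real.exp_nat_mul, ← Real.exp_add]
        apply Real.exp_le_exp.2
        have : (√3 * s / 2) ^ 2 = 3 * s ^ 2 / 4 := by
          rw [div_pow, mul_pow, sqrt_three_sq_real]; norm_num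
        rw [this]
        push_cast
        nlinarith
      have e2 : exp 0.2675 ≤ 1.366 := by
        have := Real.one_sub_le_exp_neg 0.2675
        have e3 : exp 0.2675 * exp (-0.2675) = 1 := by rw [← Real.exp_add]; simp
        nlinarith only [this, e3, Real.exp_pos 0.2675]
      have e3 : exp 1 * exp 0.2675 ≤ 2.7182818286 * 1.366 :=
        mul_le_mul Real.exp_one_lt_d9.le e2 (Real.exp_pos _).le (by norm_num)
      linarith
    have h5 : 1.81 * 1.81 < y * y := mul_self_lt_mul_self (by norm_num) hy3
    linarith
  -- Now `y ^ 2 < 3.28 ^ 2 - 1.3 ^ 2`.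
  refine ⟨⟨hs, hspi⟩, hylow, ?_⟩
  rw [lt_div_iff₀ (by positivity)]
  have : y < 3.0115 := by nlinarith
  nlinarith

theorem upper_zero_unique {z w : ℂ} (hz : D z = 0) (hz0 : 0 < z.im) (hzR : ‖z‖ ≤ 3.28)
    (hw : D w = 0) (hw0 : 0 < w.im) (hwR : ‖w‖ ≤ 3.28) : z = w := by
  -- By symmetry it suffices to exclude `Re w < Re z`, and two zeros with the same real part are
  -- equal by the modulus relation.
  have main : ∀ {s y t x : ℝ}, D ⟨-s, y⟩ = 0 → 0 < y → s ^ 2 + y ^ 2 ≤ 3.28 ^ 2 →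
      D ⟨-t, x⟩ = 0 → 0 < x → t ^ 2 + x ^ 2 ≤ 3.28 ^ 2 → ¬ s < t := by
    intro s y t x h1 hy hsy h2 hx htx hst
    have h0 : 0 < √3 := by positivity
    obtain ⟨hs, hy'⟩ := upper_zero_bounds h1 hy hsy
    obtain ⟨ht, hx'⟩ := upper_zero_bounds h2 hx htx
    have hyx : y < x := by
      have := strictMonoOn_cosh_sub_three_cos ⟨hs.1.le, hs.2.le⟩ ⟨ht.1.le, ht.2.le⟩ hst
      simp only at this
      rw [← modulus_relation h1, ← modulus_relation h2] at this
      exact (strictMonoOn_three_cosh_add_cos.lt_iff_lt hy.le hx.le).1 this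
    have hW := strictMonoOn_neg_cos_div_cosh ⟨hy'.1.le, hy'.2.le⟩ ⟨hx'.1.le, hx'.2.le⟩ hyx
    have hre : ∀ {s y : ℝ}, D ⟨-s, y⟩ = 0 →
        √3 * cos (s / 2) = sinh (√3 * s / 2) * (-cos (√3 * y / 2) / cosh (y / 2)) := by
      intro s y h
      have hre := D_re (-s) y
      rw [h] at hre
      simp only [Complex.zero_re, neg_div, mul_neg, Real.cos_neg, Real.sinh_neg] at hre
      have hc := Real.cosh_pos (y / 2)
      have h3 := sqrt_three_sq_real
      rw [mul_div_assoc', eq_div_iff hc.ne']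
      apply mul_left_cancel₀ h0.ne'
      linear_combination (cos (s / 2) * cosh (y / 2)) * h3 - hre
    have r1 := hre h1
    have r2 := hre h2
    have hcos : cos (t / 2) < cos (s / 2) :=
      Real.strictAntiOn_cos ⟨by linarith, by linarith⟩ ⟨by linarith, by linarith⟩ (by linarith)
    have hct : 0 < cos (t / 2) := Real.cos_pos_of_mem_Ioo ⟨by linarith, by linarith⟩
    have hsinh : sinh (√3 * s / 2) < sinh (√3 * t / 2) := Real.sinh_lt_sinh.2 (by nlinarith)
    have hss : 0 < sinh (√3 * s / 2) := Real.sinh_pos_iff.2 (by nlinarith)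
    simp only at hW
    generalize -cos (√3 * y / 2) / cosh (y / 2) = Wy at *
    generalize -cos (√3 * x / 2) / cosh (x / 2) = Wx at *
    have hWy : 0 < Wy := by
      by_contra hneg
      have := mul_pos h0 (hct.trans hcos)
      nlinarith
    nlinarith [mul_lt_mul_of_pos_left hcos h0, mul_lt_mul'' hsinh hW hss.le hWy.le]
  have hsq : ∀ {z : ℂ}, ‖z‖ ≤ 3.28 → (-z.re) ^ 2 + z.im ^ 2 ≤ 3.28 ^ 2 := by
    intro z hz
    have := Complex.sq_norm z
    rw [Complex.normSq_apply] at this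
    nlinarith [norm_nonneg z]
  have hz' : D ⟨-(-z.re), z.im⟩ = 0 := by rwa [neg_neg]
  have hw' : D ⟨-(-w.re), w.im⟩ = 0 := by rwa [neg_neg]
  have hre : -z.re = -w.re := le_antisymm
    (not_lt.1 (main hw' hw0 (hsq hwR) hz' hz0 (hsq hzR)))
    (not_lt.1 (main hz' hz0 (hsq hzR) hw' hw0 (hsq hwR)))
  refine Complex.ext (neg_injective hre)
    (strictMonoOn_three_cosh_add_cos.injOn hz0.le hw0.le ?_)
  rw [modulus_relation hz', modulus_relation hw', hre]

theorem D_ofReal (x : ℝ) : D x = ((3 * cos (x / 2) - √3 * sinh (√3 * x / 2) : ℝ) : ℂ) := by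
  rw [D]; push_cast; rfl

/-- On `[0, 3.28]` the function `D` decreases, and it is positive on `[-3.28, 0]`. -/
theorem real_zero_unique {x y : ℝ} (hx : D x = 0) (hxR : |x| ≤ 3.28) (hy : D y = 0)
    (hyR : |y| ≤ 3.28) : x = y := by
  have h0 : 0 < √3 := by positivity
  have hpi := Real.pi_gt_d4
  have main : ∀ {x y : ℝ}, D x = 0 → |x| ≤ 3.28 → D y = 0 → |y| ≤ 3.28 → ¬ x < y := by
    intro x y hx hxR hy hyR hlt
    rw [D_ofReal, Complex.ofReal_eq_zero] at hx hy
    rw [abs_le] at hxR hyR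
    have hsinh : sinh (√3 * x / 2) < sinh (√3 * y / 2) := Real.sinh_lt_sinh.2 (by nlinarith)
    have hx0 : 0 ≤ x := by
      by_contra hneg
      push Not at hneg
      have h1 : sinh (√3 * x / 2) ≤ √3 * x / 2 :=
        Real.sinh_le_self_iff.2 (by nlinarith)
      have h2 := mul_le_mul_of_nonneg_left h1 h0.le
      have h3 : √3 * (√3 * x / 2) = 3 / 2 * x := by
        linear_combination x / 2 * sqrt_three_sq_real
      rcases le_total (-π) x with h | h
      · have := Real.cos_nonneg_of_mem_Icc (x := x / 2) ⟨by linarith, by linarith⟩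
        linarith
      · have := Real.neg_one_le_cos (x / 2)
        linarith
    have hcos : cos (y / 2) < cos (x / 2) :=
      Real.strictAntiOn_cos ⟨by linarith, by linarith⟩ ⟨by linarith, by linarith⟩ (by linarith)
    nlinarith
  exact le_antisymm (not_lt.1 (main hy hyR hx hxR)) (not_lt.1 (main hx hxR hy hyR))

end Zeros

/-! ### Location of the zeros -/

section Numerics

open PowerSeries

/-- The rational numbers `e n` with `D (2 t) = ∑ e n * t ^ n / n!`. -/
def taylorNum (n : ℕ) : ℚ := if n % 2 = 0 then 3 * (-1) ^ (n / 2) else -3 * 3 ^ (n / 2)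

theorem coeff_DSeries (n : ℕ) :
    coeff n DSeries = (taylorNum n : ℂ) / 2 ^ n / n.factorial := by
  have h3 := sqrt_three_sq
  simp only [DSeries, map_sub, map_add, coeff_C_mul, expSeries, coeff_mk]
  rcases Nat.even_or_odd' n with ⟨k, rfl | rfl⟩
  · have h1 : (2 * k) % 2 = 0 := by omega
    have h2 : 2 * k / 2 = k := by omega
    have e1 : (Complex.I / 2) ^ (2 * k) = (-1) ^ k / 2 ^ (2 * k) := by
      rw [div_pow, pow_mul, Complex.I_sq]
    have e2 : (-(Complex.I / 2)) ^ (2 * k) = (-1) ^ k / 2 ^ (2 * k) := by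
      rw [Even.neg_pow (by simp), e1]
    have e3 : (-((√3 : ℂ) / 2)) ^ (2 * k) = ((√3 : ℂ) / 2) ^ (2 * k) := Even.neg_pow (by simp) _
    rw [e1, e2, e3, taylorNum, if_pos h1, h2]
    push_cast
    ring
  · have h1 : ¬ (2 * k + 1) % 2 = 0 := by omega
    have h2 : (2 * k + 1) / 2 = k := by omega
    have e1 : (-(Complex.I / 2)) ^ (2 * k + 1) = -(Complex.I / 2) ^ (2 * k + 1) :=
      Odd.neg_pow (by simp) _
    have e2 : (-((√3 : ℂ) / 2)) ^ (2 * k + 1) = -((√3 : ℂ) / 2) ^ (2 * k + 1) :=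
      Odd.neg_pow (by simp) _
    have e3 : (√3 : ℂ) * ((√3 : ℂ) / 2) ^ (2 * k + 1) = 3 * 3 ^ k / 2 ^ (2 * k + 1) := by
      rw [div_pow, pow_succ (√3 : ℂ), pow_mul, h3]
      linear_combination (3 : ℂ) ^ k / 2 ^ (2 * k + 1) * h3
    rw [e1, e2, taylorNum, if_neg h1, h2]
    push_cast
    linear_combination (-1 / ((2 * k + 1).factorial : ℂ)) * e3

theorem hasSum_D_two_mul (t : ℂ) :
    HasSum (fun n => (taylorNum n : ℂ) * t ^ n / n.factorial) (D (2 * t)) := by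
  refine (hasSum_DSeries (2 * t)).congr_fun fun n => ?_
  rw [coeff_DSeries, mul_pow]
  field_simp

theorem hasSum_derivD_two_mul (t : ℂ) :
    HasSum (fun n => (taylorNum (n + 1) : ℂ) * t ^ n / n.factorial) (2 * derivD (2 * t)) := by
  refine ((hasSum_derivative_DSeries (2 * t)).mul_left 2).congr_fun fun n => ?_
  have : (n : ℂ) + 1 ≠ 0 := by exact_mod_cast n.succ_ne_zero
  have : (n.factorial : ℂ) ≠ 0 := by exact_mod_cast n.factorial_ne_zero
  rw [coeff_derivative, coeff_DSeries, mul_pow, Nat.factorial_succ]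
  push_cast
  field_simp
  ring

theorem abs_taylorNum_le (n : ℕ) : |taylorNum n| ≤ 3 * 2 ^ n := by
  rcases Nat.even_or_odd' n with ⟨k, rfl | rfl⟩
  · have h2 : 2 * k / 2 = k := by omega
    rw [taylorNum, if_pos (by omega), abs_mul, abs_pow, abs_neg, abs_one, one_pow]
    have : (1 : ℚ) ≤ 2 ^ (2 * k) := one_le_pow₀ (by norm_num)
    norm_num
    linarith
  · have h2 : (2 * k + 1) / 2 = k := by omega
    rw [taylorNum, if_neg (by omega), abs_mul, abs_pow, h2]
    have : (3 : ℚ) ^ k ≤ 4 ^ k := pow_le_pow_left₀ (by norm_num) (by norm_num) k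
    have h4 : (2 : ℚ) ^ (2 * k + 1) = 2 * 4 ^ k := by rw [pow_succ, pow_mul]; norm_num; ring
    rw [h4]
    norm_num
    have : (0 : ℚ) ≤ 4 ^ k := by positivity
    linarith

/-- Horner evaluation at `a + b i` of the polynomial `∑ i < n, e (j + i) * j! / (j + i)! * X ^ i`,
as a pair of rational numbers. -/
def horner (e : ℕ → ℚ) (a b : ℚ) : ℕ → ℕ → ℚ × ℚ
  | 0, _ => (0, 0)
  | n + 1, j =>
    let h := horner e a b n (j + 1)
    (e j + (a * h.1 - b * h.2) / (j + 1), (a * h.2 + b * h.1) / (j + 1))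

theorem horner_eq_sum (e : ℕ → ℚ) (a b : ℚ) (n j : ℕ) :
    ((horner e a b n j).1 : ℂ) + (horner e a b n j).2 * Complex.I =
      ∑ i ∈ Finset.range n, (e (j + i) : ℂ) * (j.factorial / (j + i).factorial) *
        (a + b * Complex.I) ^ i := by
  induction n generalizing j with
  | zero => simp [horner]
  | succ n ih =>
    have hj : (j : ℂ) + 1 ≠ 0 := by exact_mod_cast j.succ_ne_zero
    have hf : ∀ k : ℕ, (k.factorial : ℂ) ≠ 0 := fun k => by exact_mod_cast k.factorial_ne_zero
    rw [Finset.sum_range_succ', add_zero, pow_zero, div_self (hf j)]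
    have hs : ∀ i ∈ Finset.range n,
        (e (j + (i + 1)) : ℂ) * (j.factorial / (j + (i + 1)).factorial) *
          (a + b * Complex.I) ^ (i + 1) = (a + b * Complex.I) / (j + 1) *
        ((e (j + 1 + i) : ℂ) * ((j + 1).factorial / (j + 1 + i).factorial) *
          (a + b * Complex.I) ^ i) := by
      intro i _
      have h1 : j + (i + 1) = j + 1 + i := by ring
      have := hf (j + 1 + i)
      rw [h1, Nat.factorial_succ j]
      push_cast
      field_simp
      ring
    rw [Finset.sum_congr rfl hs, ← Finset.mul_sum, ← ih (j + 1), horner]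
    push_cast
    field_simp
    linear_combination (-(b : ℂ) * (horner e a b n (j + 1)).2) * Complex.I_sq

/-- The tail of the series is dominated by a geometric series of ratio `1 / 2`, since
`|e n * t ^ n| ≤ 6 * 3.28 ^ n` and `3.28 / 7 < 1 / 2`. -/
theorem norm_sub_horner_le {e : ℕ → ℚ} (he : ∀ n, |e n| ≤ 6 * 2 ^ n) {a b : ℚ} {S : ℂ}
    (hS : HasSum (fun n => (e n : ℂ) * (a + b * Complex.I) ^ n / n.factorial) S)
    (hab : 4 * (a ^ 2 + b ^ 2) ≤ 3.28 ^ 2) {N : ℕ} (hN : 7 ≤ N) :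
    ‖S - ((horner e a b N 0).1 + (horner e a b N 0).2 * Complex.I)‖ ≤
      12 * 3.28 ^ N / N.factorial := by
  set t : ℂ := a + b * Complex.I with ht
  have htn : 2 * ‖t‖ ≤ 3.28 := by
    have h1 : ‖t‖ ^ 2 = (a : ℝ) ^ 2 + (b : ℝ) ^ 2 := by
      rw [Complex.sq_norm, Complex.normSq_apply, ht]
      simp
      ring
    have h2 : 4 * ((a : ℝ) ^ 2 + (b : ℝ) ^ 2) ≤ 3.28 ^ 2 := by
      have := (Rat.cast_le (K := ℝ)).2 hab
      push_cast at this
      norm_num at this ⊢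
      exact this
    nlinarith [norm_nonneg t]
  have hsum : ((horner e a b N 0).1 : ℂ) + (horner e a b N 0).2 * Complex.I =
      ∑ i ∈ Finset.range N, (e i : ℂ) * t ^ i / i.factorial := by
    rw [horner_eq_sum]
    refine Finset.sum_congr rfl fun i _ => ?_
    rw [zero_add]
    simp
    ring
  have htail := (hasSum_nat_add_iff' N).2 hS
  rw [← hsum] at htail
  have hgeo : HasSum (fun n : ℕ => 6 * 3.28 ^ N / N.factorial * (1 / 2 : ℝ) ^ n)
      (6 * 3.28 ^ N / N.factorial * 2) := hasSum_geometric_two.mul_left _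
  refine (htail.norm_le_of_bounded hgeo fun n => ?_).trans (le_of_eq (by ring))
  have hfac : (0 : ℝ) < N.factorial := by exact_mod_cast N.factorial_pos
  have hfac' : (N.factorial : ℝ) * 7 ^ n ≤ (n + N).factorial := by
    have h1 := Nat.factorial_mul_pow_le_factorial (m := N) (n := n)
    have h2 : 7 ^ n ≤ (N + 1) ^ n := Nat.pow_le_pow_left (by omega) n
    rw [add_comm n N]
    exact_mod_cast (Nat.mul_le_mul_left _ h2).trans h1
  have he' : ‖(e (n + N) : ℂ)‖ ≤ 6 * 2 ^ (n + N) := by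
    rw [Complex.norm_ratCast]
    exact_mod_cast (Rat.cast_le (K := ℝ)).2 (he (n + N))
  have hpow : (2 * ‖t‖) ^ (n + N) ≤ 3.28 ^ (n + N) := pow_le_pow_left₀ (by positivity) htn _
  have h35 : (3.28 : ℝ) ^ n ≤ 7 ^ n * (1 / 2) ^ n := by
    rw [← mul_pow]
    exact pow_le_pow_left₀ (by norm_num) (by norm_num) n
  rw [norm_div, norm_mul, norm_pow, Complex.norm_natCast]
  calc ‖(e (n + N) : ℂ)‖ * ‖t‖ ^ (n + N) / (n + N).factorial
      ≤ 6 * 2 ^ (n + N) * ‖t‖ ^ (n + N) / (N.factorial * 7 ^ n) := by gcongr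
    _ = 6 * (2 * ‖t‖) ^ (n + N) / (N.factorial * 7 ^ n) := by rw [mul_pow]; ring
    _ ≤ 6 * 3.28 ^ (n + N) / (N.factorial * 7 ^ n) := by gcongr
    _ = 6 * 3.28 ^ N / N.factorial * (3.28 ^ n / 7 ^ n) := by
      rw [pow_add]; field_simp
    _ ≤ 6 * 3.28 ^ N / N.factorial * (1 / 2) ^ n := by
      gcongr
      rw [div_le_iff₀ (by positivity)]
      linarith

theorem norm_D_sub_horner_le {a b : ℚ} (hab : 4 * (a ^ 2 + b ^ 2) ≤ 3.28 ^ 2) :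
    ‖D (2 * (a + b * Complex.I)) - ((horner taylorNum a b 30 0).1 +
      (horner taylorNum a b 30 0).2 * Complex.I)‖ ≤ 1e-15 := by
  refine (norm_sub_horner_le (fun n => (abs_taylorNum_le n).trans ?_)
    (hasSum_D_two_mul _) hab (by norm_num)).trans ?_
  · have : (0 : ℚ) ≤ 2 ^ n := by positivity
    linarith
  · norm_num [Nat.factorial]

theorem norm_derivD_sub_horner_le {a b : ℚ} (hab : 4 * (a ^ 2 + b ^ 2) ≤ 3.28 ^ 2) :
    ‖2 * derivD (2 * (a + b * Complex.I)) - ((horner (fun n => taylorNum (n + 1)) a b 16 0).1 +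
      (horner (fun n => taylorNum (n + 1)) a b 16 0).2 * Complex.I)‖ ≤ 1e-3 := by
  refine (norm_sub_horner_le (fun n => (abs_taylorNum_le (n + 1)).trans ?_)
    (hasSum_derivD_two_mul _) hab (by norm_num)).trans ?_
  · rw [pow_succ]; linarith
  · norm_num [Nat.factorial]

theorem norm_cosh_le (w : ℂ) : ‖Complex.cosh w‖ ≤ Real.exp ‖w‖ := by
  have h1 := Complex.norm_exp_le_exp_norm w
  have h2 := Complex.norm_exp_le_exp_norm (-w)
  rw [norm_neg] at h2
  rw [Complex.cosh, norm_div, Complex.norm_ofNat]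
  have := norm_add_le (Complex.exp w) (Complex.exp (-w))
  linarith

theorem norm_sinh_le (w : ℂ) : ‖Complex.sinh w‖ ≤ Real.exp ‖w‖ := by
  have h1 := Complex.norm_exp_le_exp_norm w
  have h2 := Complex.norm_exp_le_exp_norm (-w)
  rw [norm_neg] at h2
  rw [Complex.sinh, norm_div, Complex.norm_ofNat]
  have := norm_sub_le (Complex.exp w) (Complex.exp (-w))
  linarith

theorem hasDerivAt_derivD (z : ℂ) : HasDerivAt derivD (-(3 / 4) * (Complex.cos (z / 2) +
    (Real.sqrt 3 : ℂ) * Complex.sinh ((Real.sqrt 3 : ℂ) * z / 2))) z := by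
  have h1 : HasDerivAt (fun z : ℂ => z / 2) (1 / 2) z := (hasDerivAt_id z).div_const 2
  have h2 : HasDerivAt (fun z : ℂ => (Real.sqrt 3 : ℂ) * z / 2) ((Real.sqrt 3 : ℂ) * 1 / 2) z :=
    ((hasDerivAt_id z).const_mul _).div_const 2
  refine ((h1.csin.add h2.ccosh).const_mul (-(3 / 2))).congr_deriv ?_
  ring

theorem norm_derivD_sub_le {z w : ℂ} (hz : ‖z‖ ≤ 3.28) (hw : ‖w‖ ≤ 3.28) :
    ‖derivD w - derivD z‖ ≤ 50 * ‖w - z‖ := by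
  refine (convex_closedBall (0 : ℂ) 3.28).norm_image_sub_le_of_norm_hasDerivWithin_le
    (fun x _ => (hasDerivAt_derivD x).hasDerivWithinAt) (fun x hx => ?_) (by simpa using hz)
    (by simpa using hw)
  rw [mem_closedBall_zero_iff] at hx
  obtain ⟨hl, hu⟩ := sqrt_three_bounds
  have he : Real.exp 3 ≤ 21 := by
    have h : Real.exp 3 = Real.exp 1 ^ 3 := by rw [← Real.exp_nat_mul]; norm_num
    rw [h]
    exact (pow_le_pow_left₀ (Real.exp_pos 1).le Real.exp_one_lt_d9.le 3).trans (by norm_num)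
  have h1 : ‖Complex.cos (x / 2)‖ ≤ 21 := by
    rw [← Complex.cosh_mul_I]
    refine (norm_cosh_le _).trans ((Real.exp_le_exp.2 ?_).trans he)
    rw [norm_mul, Complex.norm_I, norm_div, Complex.norm_ofNat]
    linarith
  have h3 : ‖(Real.sqrt 3 : ℂ)‖ = Real.sqrt 3 := by
    rw [Complex.norm_real, Real.norm_of_nonneg (Real.sqrt_nonneg 3)]
  have h2 : ‖Complex.sinh ((Real.sqrt 3 : ℂ) * x / 2)‖ ≤ 21 := by
    refine (norm_sinh_le _).trans ((Real.exp_le_exp.2 ?_).trans he)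
    rw [norm_div, norm_mul, h3, Complex.norm_ofNat]
    nlinarith [norm_nonneg x]
  have h4 := norm_add_le (Complex.cos (x / 2))
    ((Real.sqrt 3 : ℂ) * Complex.sinh ((Real.sqrt 3 : ℂ) * x / 2))
  have h5 : ‖(-(3 / 4) : ℂ)‖ = 3 / 4 := by rw [norm_neg]; norm_num
  rw [norm_mul, h5]
  rw [norm_mul, h3] at h4
  nlinarith [norm_nonneg (Complex.sinh ((Real.sqrt 3 : ℂ) * x / 2))]

/-- A twelve-digit approximation of the zero of `D` of second smallest modulus in the upper half
plane. -/
noncomputable def approxZero : ℂ :=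
  2 * (((-1029147560465 / 10 ^ 12 : ℚ) : ℂ) + ((1276299213679 / 10 ^ 12 : ℚ) : ℂ) * Complex.I)

theorem normSq_approxZero : ‖approxZero‖ ^ 2 =
    (2 * 1.029147560465) ^ 2 + (2 * 1.276299213679) ^ 2 := by
  rw [Complex.sq_norm, Complex.normSq_apply, approxZero]
  simp
  norm_num

theorem norm_approxZero_bounds :
    1 / 0.3049639860 + 1e-11 < ‖approxZero‖ ∧ ‖approxZero‖ < 1 / 0.3049639859 - 1e-11 := by
  have h := normSq_approxZero
  constructor
  · refine lt_of_pow_lt_pow_left₀ 2 (norm_nonneg _) ?_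
    rw [h]; norm_num
  · refine lt_of_pow_lt_pow_left₀ 2 (by norm_num) ?_
    rw [h]; norm_num

theorem norm_D_approxZero_le : ‖D approxZero‖ ≤ 1e-11 := by
  have h := norm_D_sub_horner_le (a := -1029147560465 / 10 ^ 12) (b := 1276299213679 / 10 ^ 12)
    (by norm_num)
  have h1 : |(horner taylorNum (-1029147560465 / 10 ^ 12) (1276299213679 / 10 ^ 12) 30 0).1|
      ≤ 4e-12 := by decide +kernel
  have h2 : |(horner taylorNum (-1029147560465 / 10 ^ 12) (1276299213679 / 10 ^ 12) 30 0).2|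
      ≤ 4e-12 := by decide +kernel
  rw [← approxZero] at h
  generalize horner taylorNum (-1029147560465 / 10 ^ 12) (1276299213679 / 10 ^ 12) 30 0 = p at *
  have h1' : ‖(p.1 : ℂ)‖ ≤ 4e-12 := by
    rw [Complex.norm_ratCast]
    have := (Rat.cast_le (K := ℝ)).2 h1
    push_cast at this
    norm_num at this ⊢
    exact this
  have h2' : ‖(p.2 : ℂ) * Complex.I‖ ≤ 4e-12 := by
    rw [norm_mul, Complex.norm_I, mul_one, Complex.norm_ratCast]
    have := (Rat.cast_le (K := ℝ)).2 h2
    push_cast at this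
    norm_num at this ⊢
    exact this
  have h3 := norm_le_norm_sub_add (D approxZero) ((p.1 : ℂ) + p.2 * Complex.I)
  have h4 := norm_add_le (p.1 : ℂ) (p.2 * Complex.I)
  linarith

theorem five_le_norm_derivD_approxZero : 5 ≤ ‖derivD approxZero‖ := by
  have h := norm_derivD_sub_horner_le (a := -1029147560465 / 10 ^ 12) (b := 1276299213679 / 10 ^ 12)
    (by norm_num)
  have h1 : 10.4 ≤ (horner (fun n => taylorNum (n + 1)) (-1029147560465 / 10 ^ 12)
      (1276299213679 / 10 ^ 12) 16 0).1 := by decide +kernel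
  rw [← approxZero] at h
  generalize horner (fun n => taylorNum (n + 1)) (-1029147560465 / 10 ^ 12)
    (1276299213679 / 10 ^ 12) 16 0 = p at *
  have h1' : (10.4 : ℝ) ≤ p.1 := by
    have := (Rat.cast_le (K := ℝ)).2 h1
    push_cast at this
    norm_num at this ⊢
    exact this
  have h2 := (Complex.abs_re_le_norm _).trans h
  have h3 := Complex.abs_re_le_norm (2 * derivD approxZero)
  rw [norm_mul, Complex.norm_ofNat] at h3
  simp only [Complex.sub_re, Complex.add_re, Complex.ratCast_re, Complex.mul_re, Complex.I_re,
    Complex.I_im, Complex.ratCast_im, mul_zero, zero_mul, sub_zero, add_zero] at h2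
  have h4 := (abs_le.1 h2).1
  have h5 := le_abs_self (2 * derivD approxZero).re
  simp only [Complex.mul_re] at h5 h3
  norm_num at h4 h1' h5 h3 ⊢
  linarith

theorem differentiable_D : Differentiable ℂ D := fun z => (hasDerivAt_D z).differentiableAt

/-- On the circle of radius `1e-11` about `approxZero`, `D` differs from its value at the centre by
at least `4e-11`, as `|D'| ≥ 5` at the centre; as `D` is smaller than half of that at the centre, the
disc contains a zero. -/
theorem exists_zero_near_approxZero :
    ∃ ρ : ℂ, D ρ = 0 ∧ ‖ρ - approxZero‖ ≤ 1e-11 ∧ derivD ρ ≠ 0 := by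
  have hb := norm_approxZero_bounds.2
  have hball : ∀ w ∈ Metric.closedBall approxZero 1e-11, ‖w‖ ≤ 3.28 := by
    intro w hw
    rw [mem_closedBall_iff_norm] at hw
    have := norm_le_norm_sub_add w approxZero
    norm_num at hb hw ⊢
    linarith
  have hc : ‖approxZero‖ ≤ 3.28 := hball _ (Metric.mem_closedBall_self (by norm_num))
  have hsub : ∀ w ∈ Metric.sphere approxZero 1e-11, 4e-11 ≤ ‖D w - D approxZero‖ := by
    intro w hw
    have hw' := Metric.sphere_subset_closedBall hw
    have hlip := (convex_closedBall approxZero 1e-11).norm_image_sub_le_of_norm_hasDerivWithin_le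
      (f := fun x => D x - derivD approxZero * x) (C := 50 * 1e-11)
      (fun x _ => ((hasDerivAt_D x).sub
        ((hasDerivAt_id x).const_mul (derivD approxZero))).hasDerivWithinAt)
      (fun x hx => by
        have := norm_derivD_sub_le hc (hball x hx)
        rw [mem_closedBall_iff_norm] at hx
        rw [mul_one]
        linarith)
      (Metric.mem_closedBall_self (by norm_num)) hw'
    rw [mem_sphere_iff_norm] at hw
    have h5 := five_le_norm_derivD_approxZero
    have e : derivD approxZero * (w - approxZero) = (D w - D approxZero) -
        ((D w - derivD approxZero * w) - (D approxZero - derivD approxZero * approxZero)) := by ring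
    have h6 := norm_sub_le (D w - D approxZero)
      ((D w - derivD approxZero * w) - (D approxZero - derivD approxZero * approxZero))
    rw [← e, norm_mul, hw] at h6
    simp only [hw] at hlip
    norm_num at h6 hlip ⊢
    linarith
  have hD0 := norm_D_approxZero_le
  have hev : ∃ᶠ z in nhds approxZero, D z ≠ D approxZero := by
    have hne : derivD approxZero ≠ 0 := by
      have := five_le_norm_derivD_approxZero
      rw [← norm_pos_iff]; linarith
    exact ((hasDerivAt_D approxZero).eventually_ne hne).frequently.filter_mono
      nhdsWithin_le_nhds
  have himg := DiffContOnCl.ball_subset_image_closedBall differentiable_D.diffContOnCl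
    (by norm_num) hsub hev
  obtain ⟨ρ, hρ, hρ0⟩ := himg (show (0 : ℂ) ∈ Metric.ball (D approxZero) (4e-11 / 2) by
    rw [mem_ball_iff_norm, zero_sub, norm_neg]
    norm_num at hD0 ⊢
    linarith)
  have hρ' := hball ρ hρ
  rw [mem_closedBall_iff_norm] at hρ
  refine ⟨ρ, hρ0, hρ, fun h0 => ?_⟩
  have h1 := norm_derivD_sub_le hc hρ'
  have h2 := five_le_norm_derivD_approxZero
  rw [h0, zero_sub, norm_neg] at h1
  norm_num at hρ
  linarith

/-- The zero of `D` of second smallest modulus in the upper half plane. -/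
theorem exists_upper_zero : ∃ ρ : ℂ, D ρ = 0 ∧ derivD ρ ≠ 0 ∧ 0 < ρ.im ∧
    1 / 0.3049639860 < ‖ρ‖ ∧ ‖ρ‖ < 1 / 0.3049639859 := by
  obtain ⟨ρ, h0, h1, h2⟩ := exists_zero_near_approxZero
  obtain ⟨hl, hu⟩ := norm_approxZero_bounds
  refine ⟨ρ, h0, h2, ?_, ?_, ?_⟩
  · have h3 := (Complex.abs_im_le_norm (ρ - approxZero)).trans h1
    have h4 : approxZero.im = 2 * 1.276299213679 := by
      simp [approxZero]; norm_num
    rw [Complex.sub_im, h4] at h3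
    have := (abs_le.1 h3).1
    norm_num at this ⊢
    linarith
  · have := norm_sub_norm_le approxZero ρ
    rw [norm_sub_rev] at this
    linarith
  · have := norm_le_norm_sub_add ρ approxZero
    linarith

theorem D_two_mul_rat_re (a : ℚ) (ha : 4 * a ^ 2 ≤ 3.28 ^ 2) :
    |(D ((2 * a : ℝ) : ℂ)).re - (horner taylorNum a 0 30 0).1| ≤ 1e-15 := by
  have h := norm_D_sub_horner_le (a := a) (b := 0) (by simpa using ha)
  have e : ((2 * a : ℝ) : ℂ) = 2 * ((a : ℂ) + ((0 : ℚ) : ℂ) * Complex.I) := by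
    push_cast; ring
  rw [← e] at h
  simpa using (Complex.abs_re_le_norm _).trans h

/-- The smallest zero of `D`. -/
theorem exists_real_zero : ∃ α : ℝ, D α = 0 ∧ derivD α ≠ 0 ∧
    1 / 0.7693323707 < α ∧ α < 1 / 0.7693323706 := by
  have h1 := D_two_mul_rat_re (1 / 1.5386647414) (by norm_num)
  have h2 := D_two_mul_rat_re (1 / 1.5386647412) (by norm_num)
  have c1 : 1e-12 ≤ (horner taylorNum (1 / 1.5386647414) 0 30 0).1 := by decide +kernel
  have c2 : (horner taylorNum (1 / 1.5386647412) 0 30 0).1 ≤ -1e-12 := by decide +kernel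
  have c1' := (Rat.cast_le (K := ℝ)).2 c1
  have c2' := (Rat.cast_le (K := ℝ)).2 c2
  generalize (horner taylorNum (1 / 1.5386647414) 0 30 0).1 = p at *
  generalize (horner taylorNum (1 / 1.5386647412) 0 30 0).1 = q at *
  have e1 : (2 * ((1 / 1.5386647414 : ℚ) : ℝ)) = 1 / 0.7693323707 := by push_cast; norm_num
  have e2 : (2 * ((1 / 1.5386647412 : ℚ) : ℝ)) = 1 / 0.7693323706 := by push_cast; norm_num
  rw [e1, abs_le] at h1
  rw [e2, abs_le] at h2
  have hcont : ContinuousOn (fun x : ℝ => (D x).re)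
      (Set.Icc (1 / 0.7693323707) (1 / 0.7693323706)) :=
    (Complex.continuous_re.comp
      (differentiable_D.continuous.comp Complex.continuous_ofReal)).continuousOn
  push_cast at c1' c2'
  obtain ⟨α, hα, hα0⟩ := intermediate_value_Ioo' (by norm_num) hcont
    (show (0 : ℝ) ∈ Set.Ioo _ _ from ⟨by norm_num at h2 c2' ⊢; linarith,
      by norm_num at h1 c1' ⊢; linarith⟩)
  have hb : 0 < α ∧ α < 2 := by
    have h1 := hα.1
    have h2 := hα.2
    norm_num at h1 h2
    constructor <;> linarith
  refine ⟨α, ?_, ?_, hα.1, hα.2⟩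
  · simp only [D_ofReal, Complex.ofReal_re] at hα0
    rw [D_ofReal, hα0, Complex.ofReal_zero]
  · have e : derivD α = ((-(3 / 2) * (Real.sin (α / 2) + Real.cosh (√3 * α / 2)) : ℝ) : ℂ) := by
      rw [derivD]; push_cast; rfl
    rw [e, Complex.ofReal_ne_zero]
    have hs : 0 < Real.sin (α / 2) :=
      Real.sin_pos_of_pos_of_lt_pi (by linarith) (by linarith [Real.pi_gt_three])
    have hc := Real.cosh_pos (√3 * α / 2)
    exact mul_ne_zero (by norm_num) (by positivity)

end Numerics

/-! ### Taylor coefficients of a logarithmic derivative -/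

section Coefficients

/-- Division of an entire function by linear factors at distinct zeros. -/
theorem exists_eq_prod_mul {g : ℂ → ℂ} (hg : Differentiable ℂ g) (s : Finset ℂ)
    (hs : ∀ a ∈ s, g a = 0) :
    ∃ Q : ℂ → ℂ, Differentiable ℂ Q ∧ ∀ z, g z = (∏ a ∈ s, (z - a)) * Q z := by
  classical
  induction s using Finset.induction_on with
  | empty => exact ⟨g, hg, by simp⟩
  | insert a s ha ih =>
    obtain ⟨Q, hQ, hgQ⟩ := ih fun b hb => hs b (Finset.mem_insert_of_mem hb)
    have hQa : Q a = 0 := by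
      have h := hgQ a
      rw [hs a (Finset.mem_insert_self a s)] at h
      refine (mul_eq_zero.1 h.symm).resolve_left (Finset.prod_ne_zero_iff.2 fun b hb => ?_)
      rw [sub_ne_zero]
      rintro rfl
      exact ha hb
    refine ⟨dslope Q a, fun z => ?_, fun z => ?_⟩
    · have h := (Complex.differentiableOn_dslope (f := Q) (s := Set.univ) (c := a) univ_mem).2
        hQ.differentiableOn
      exact h.differentiableAt univ_mem
    · have h := sub_smul_dslope Q a z
      rw [hQa, sub_zero, smul_eq_mul] at h
      rw [Finset.prod_insert ha, hgQ z, ← h]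
      ring

/-- Singularity analysis of a logarithmic derivative: if the zeros of the entire function `g` in
the closed disc of radius `R` are the simple zeros in `s`, then the Taylor coefficients of `g' / g`
are, up to `O(r ^ (-n))` for `r < R`, those of `∑ 1 / (z - a)` over `a ∈ s`. -/
theorem exists_norm_coeff_logDeriv_le {g : ℂ → ℂ} (hg : Differentiable ℂ g) {s : Finset ℂ}
    {R : NNReal} (h0 : g 0 ≠ 0) (hs : ∀ a ∈ s, g a = 0 ∧ deriv g a ≠ 0)
    (hsR : ∀ z, ‖z‖ ≤ R → g z = 0 → z ∈ s) (hR : 0 < R) {c : ℕ → ℂ}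
    (hc : ∀ᶠ z in nhds (0 : ℂ), HasSum (fun n => c n * z ^ n) (deriv g z / g z))
    {r : NNReal} (hr : r < R) :
    ∃ C : ℝ, ∀ n, ‖c n + ∑ a ∈ s, a⁻¹ ^ (n + 1)‖ * r ^ n ≤ C := by
  classical
  obtain ⟨Q, hQ, hgQ⟩ := exists_eq_prod_mul hg s fun a ha => (hs a ha).1
  -- As the zeros are simple, `Q` does not vanish at them.
  have hQa : ∀ a ∈ s, Q a ≠ 0 := by
    intro a ha h
    apply (hs a ha).2
    have hd : HasDerivAt (fun z => (z - a) * ((∏ b ∈ s.erase a, (z - b)) * Q z))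
        (1 * ((∏ b ∈ s.erase a, (a - b)) * Q a) +
          (a - a) * deriv (fun z => (∏ b ∈ s.erase a, (z - b)) * Q z) a) a := by
      refine ((hasDerivAt_id a).sub_const a).mul (DifferentiableAt.hasDerivAt ?_)
      exact DifferentiableAt.mul (by fun_prop) (hQ a)
    have he : g = fun z => (z - a) * ((∏ b ∈ s.erase a, (z - b)) * Q z) := by
      funext z
      rw [hgQ z, ← Finset.mul_prod_erase s _ ha, mul_assoc]
    rw [he, hd.deriv, h]
    ring
  have hQR : ∀ z ∈ Metric.closedBall (0 : ℂ) R, Q z ≠ 0 := by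
    intro z hz h
    rw [mem_closedBall_zero_iff] at hz
    exact hQa z (hsR z hz (by rw [hgQ, h, mul_zero])) h
  have hdQ : Differentiable ℂ (deriv Q) := fun z =>
    (hQ.analyticAt z).deriv.differentiableAt
  have hlog : DifferentiableOn ℂ (fun z => deriv Q z / Q z) (Metric.closedBall 0 R) :=
    hdQ.differentiableOn.div hQ.differentiableOn hQR
  have hps := hlog.hasFPowerSeriesOnBall hR
  -- Near `0`, the series `∑ (c n + ∑ a⁻¹ ^ (n + 1)) z ^ n` sums to `g' / g - ∑ 1 / (z - a) = Q' / Q`,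
  -- so it is the Taylor series of `Q' / Q`, which converges in the whole disc of radius `R`.
  have hps' : HasFPowerSeriesAt (fun z => deriv Q z / Q z)
      (FormalMultilinearSeries.ofScalars ℂ fun n => c n + ∑ a ∈ s, a⁻¹ ^ (n + 1)) 0 := by
    rw [hasFPowerSeriesAt_iff]
    have hs0 : ∀ a ∈ s, a ≠ 0 := by
      rintro a ha rfl
      exact h0 (hs 0 ha).1
    have hnear : ∀ᶠ z in nhds (0 : ℂ), ∀ a ∈ s, ‖z‖ < ‖a‖ := by
      rw [Filter.eventually_all_finset]
      intro a ha
      have := norm_pos_iff.2 (hs0 a ha)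
      filter_upwards [Metric.ball_mem_nhds (0 : ℂ) this] with z hz
      simpa using hz
    filter_upwards [hc, hnear, hg.continuous.continuousAt.eventually_ne h0] with z hz hza hgz
    have hza' : ∀ a ∈ s, z - a ≠ 0 := by
      intro a ha h
      rw [sub_eq_zero] at h
      exact (hza a ha).ne (by rw [h])
    have hgeo : ∀ a ∈ s, HasSum (fun n => a⁻¹ ^ (n + 1) * z ^ n) (-(1 / (z - a))) := by
      intro a ha
      have ha0 := hs0 a ha
      have hlt : ‖z / a‖ < 1 := by
        rw [norm_div, div_lt_one (norm_pos_iff.2 ha0)]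
        exact hza a ha
      have h2 : -(1 / (z - a)) = a⁻¹ * (1 - z / a)⁻¹ := by
        have h1 := hza' a ha
        have h2 : a - z ≠ 0 := by
          rw [← neg_sub]; exact neg_ne_zero.2 h1
        have h3 : 1 - z / a = (a - z) / a := by field_simp
        rw [h3, inv_div, ← neg_sub a z]
        field_simp
      rw [h2]
      refine ((hasSum_geometric_of_norm_lt_one hlt).mul_left a⁻¹).congr_fun fun n => ?_
      rw [pow_succ, inv_pow, div_pow]
      ring
    have hQz : Q z ≠ 0 := by
      intro h
      rw [hgQ, h, mul_zero] at hgz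
      exact hgz rfl
    have hdiv : deriv g z / g z = ∑ a ∈ s, 1 / (z - a) + deriv Q z / Q z := by
      have he : g = fun z => (∏ a ∈ s, (z - a)) * Q z := funext hgQ
      have h1 := logDeriv_mul (f := fun z => ∏ a ∈ s, (z - a)) (g := Q) z
        (Finset.prod_ne_zero_iff.2 hza') hQz (by fun_prop) (hQ z)
      rw [← he, logDeriv_prod (f := fun a z => z - a) hza' (by fun_prop)] at h1
      simpa [logDeriv_apply] using h1
    have hsum := hz.add (hasSum_sum hgeo)
    rw [hdiv, Finset.sum_neg_distrib, add_comm, neg_add_cancel_left] at hsum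
    rw [zero_add]
    refine hsum.congr_fun fun n => ?_
    rw [FormalMultilinearSeries.coeff_ofScalars, smul_eq_mul, mul_comm, add_mul, Finset.sum_mul]
  have heq := hps'.eq_formalMultilinearSeries hps.hasFPowerSeriesAt
  have hrad : (r : ENNReal) < (cauchyPowerSeries (fun z => deriv Q z / Q z) 0 R).radius :=
    lt_of_lt_of_le (by exact_mod_cast hr) hps.r_le
  obtain ⟨C, -, hC⟩ := FormalMultilinearSeries.norm_mul_pow_le_of_lt_radius _ hrad
  refine ⟨C, fun n => ?_⟩
  have := hC n
  rw [← heq, FormalMultilinearSeries.norm_apply_eq_norm_coef,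
    FormalMultilinearSeries.coeff_ofScalars] at this
  exact this

end Coefficients

/-! ### The asymptotic expansion -/

section Asymptotics

open PowerSeries

theorem deriv_D (z : ℂ) : deriv D z = derivD z := (hasDerivAt_D z).deriv

theorem D_zero : D 0 = 3 := by simp [D]

theorem derivD_conj (z : ℂ) : derivD (starRingEnd ℂ z) = starRingEnd ℂ (derivD z) := by
  simp only [derivD, map_add, map_mul, ← Complex.sin_conj, ← Complex.cosh_conj, map_div₀,
    Complex.conj_ofReal, map_ofNat, map_neg]

theorem hasSum_altSeries_logDeriv :
    ∀ᶠ z in nhds (0 : ℂ), HasSum (fun n => -(1 / 2) * coeff n (altSeries false) * z ^ n)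
      (deriv D z / D z) := by
  have h0 : D 0 ≠ 0 := by rw [D_zero]; norm_num
  filter_upwards [differentiable_D.continuous.continuousAt.eventually_ne h0,
    Metric.ball_mem_nhds (0 : ℂ) one_pos] with z hz hz1
  rw [mem_ball_zero_iff] at hz1
  have h := (summable_norm_altSeries hz1).of_norm.hasSum.mul_left (-(1 / 2))
  have h2 : deriv D z / D z = -(1 / 2) * ∑' n, coeff n (altSeries false) * z ^ n := by
    rw [deriv_D, div_eq_iff hz]
    linear_combination (-(1 / 2)) * -(tsum_altSeries_mul_D hz1)
  rw [h2]
  simpa only [mul_assoc] using h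

/-- The zeros of `D` in the disc of radius `3.28`. -/
theorem eq_of_D_eq_zero {α : ℝ} {ρ z : ℂ} (hα : D α = 0) (hαR : |α| ≤ 3.28) (hρ : D ρ = 0)
    (hρ0 : 0 < ρ.im) (hρR : ‖ρ‖ ≤ 3.28) (hz : D z = 0) (hzR : ‖z‖ ≤ 3.28) :
    z = α ∨ z = ρ ∨ z = starRingEnd ℂ ρ := by
  rcases lt_trichotomy z.im 0 with h | h | h
  · refine Or.inr (Or.inr ?_)
    have := upper_zero_unique (z := starRingEnd ℂ z) (by rw [D_conj, hz, map_zero])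
      (by simpa using h) (by simpa using hzR) hρ hρ0 hρR
    rw [← this, Complex.conj_conj]
  · have e : z = ((z.re : ℝ) : ℂ) := Complex.ext rfl (by simpa using h)
    rw [e] at hz hzR
    rw [Complex.norm_real, Real.norm_eq_abs] at hzR
    left
    rw [e, real_zero_unique hz hzR hα hαR]
  · exact Or.inr (Or.inl (upper_zero_unique hz h hzR hρ hρ0 hρR))

/-- The zeros `ρ` and `conj ρ` contribute terms of the order of the error, so only `α` remains in the
main term. -/
theorem isBigO_coeff {α : ℝ} {ρ : ℂ} (hα : D α = 0) (hα' : derivD α ≠ 0) (hαR : |α| ≤ 3.28)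
    (hρ : D ρ = 0) (hρ' : derivD ρ ≠ 0) (hρ0 : 0 < ρ.im) (hρR : ‖ρ‖ < 3.28) :
    (fun n : ℕ => (f n : ℝ) / (Nat.factorial n : ℝ) - 2 * α⁻¹ ^ (n + 1))
      =O[atTop] (fun n : ℕ => ‖ρ‖⁻¹ ^ n) := by
  classical
  have hρpos : 0 < ‖ρ‖ := norm_pos_iff.2 (by rintro rfl; simp at hρ0)
  have hne1 : (α : ℂ) ≠ ρ := by rintro h; rw [← h] at hρ0; simp at hρ0
  have hne2 : (α : ℂ) ≠ starRingEnd ℂ ρ := by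
    intro h
    have := congrArg Complex.im h
    simp at this
    linarith
  have hne3 : ρ ≠ starRingEnd ℂ ρ := by
    intro h
    have := congrArg Complex.im h
    simp at this
    linarith
  have hs : ∀ a ∈ ({(α : ℂ), ρ, starRingEnd ℂ ρ} : Finset ℂ), D a = 0 ∧ deriv D a ≠ 0 := by
    intro a ha
    simp only [Finset.mem_insert, Finset.mem_singleton] at ha
    rw [deriv_D]
    rcases ha with rfl | rfl | rfl
    · exact ⟨hα, hα'⟩
    · exact ⟨hρ, hρ'⟩
    · rw [D_conj, derivD_conj, hρ, map_zero]
      exact ⟨rfl, (map_ne_zero _).2 hρ'⟩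
  obtain ⟨C, hC⟩ := exists_norm_coeff_logDeriv_le differentiable_D (R := 3.28)
    (r := ‖ρ‖₊) (by rw [D_zero]; norm_num) hs (fun z hz hDz => by
      simp only [Finset.mem_insert, Finset.mem_singleton]
      exact eq_of_D_eq_zero hα hαR hρ hρ0 hρR.le hDz (by exact_mod_cast hz))
    (by norm_num) hasSum_altSeries_logDeriv
    (by rw [← NNReal.coe_lt_coe, coe_nnnorm]; exact hρR)
  refine IsBigO.of_bound (2 * C + 4 * ‖ρ‖⁻¹) (Eventually.of_forall fun n => ?_)
  have hn := hC n
  rw [Finset.sum_insert (by simp [hne1, hne2]), Finset.sum_insert (by simp [hne3]),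
    Finset.sum_singleton] at hn
  have hn' : ‖-(1 / 2) * coeff n (altSeries false) + ((α : ℂ)⁻¹ ^ (n + 1) + (ρ⁻¹ ^ (n + 1) +
      (starRingEnd ℂ ρ)⁻¹ ^ (n + 1)))‖ ≤ C * ‖ρ‖⁻¹ ^ n := by
    rw [inv_pow ‖ρ‖, ← div_eq_mul_inv, le_div_iff₀ (by positivity)]
    exact hn
  set X := -(1 / 2) * coeff n (altSeries false) + ((α : ℂ)⁻¹ ^ (n + 1) + (ρ⁻¹ ^ (n + 1) +
      (starRingEnd ℂ ρ)⁻¹ ^ (n + 1)))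
  have hF : (((f n : ℝ) / (Nat.factorial n : ℝ) - 2 * α⁻¹ ^ (n + 1) : ℝ) : ℂ) =
      -2 * X + (2 * ρ⁻¹ ^ (n + 1) + 2 * (starRingEnd ℂ ρ)⁻¹ ^ (n + 1)) := by
    have : coeff n (altSeries false) = (f n : ℂ) / n.factorial := by
      rw [altSeries, coeff_mk, f_eq_altCount]
    simp only [X, this]
    push_cast
    ring
  rw [← Complex.norm_real, hF, norm_pow, norm_inv, norm_norm]
  have n1 : ‖2 * ρ⁻¹ ^ (n + 1)‖ = 2 * ‖ρ‖⁻¹ * ‖ρ‖⁻¹ ^ n := by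
    rw [norm_mul, norm_pow, norm_inv, Complex.norm_ofNat]; ring
  have n2 : ‖2 * (starRingEnd ℂ ρ)⁻¹ ^ (n + 1)‖ = 2 * ‖ρ‖⁻¹ * ‖ρ‖⁻¹ ^ n := by
    rw [norm_mul, norm_pow, norm_inv, Complex.norm_ofNat, RCLike.norm_conj]; ring
  have n3 : ‖-2 * X‖ = 2 * ‖X‖ := by rw [norm_mul, norm_neg, Complex.norm_ofNat]
  have t1 := norm_add_le (-2 * X) (2 * ρ⁻¹ ^ (n + 1) + 2 * (starRingEnd ℂ ρ)⁻¹ ^ (n + 1))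
  have t2 := norm_add_le (2 * ρ⁻¹ ^ (n + 1)) (2 * (starRingEnd ℂ ρ)⁻¹ ^ (n + 1))
  rw [n1, n2] at t2
  rw [n3] at t1
  linarith

end Asymptotics

end PeaksValleys

theorem theorem3 :
    ∃ α γ β δ : ℝ,
      -- `α` is positive and is the unique zero of `D` of smallest modulus
      0 < α ∧ PeaksValleys.D (α : ℂ) = 0 ∧
      (∀ z : ℂ, PeaksValleys.D z = 0 → z ≠ (α : ℂ) → α < ‖z‖) ∧
      -- `γ` is the modulus of the next zeros of `D`
      IsLeast {r : ℝ | ∃ z : ℂ, PeaksValleys.D z = 0 ∧ z ≠ (α : ℂ) ∧ ‖z‖ = r} γ ∧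
      -- the constants `β = 1/α = 0.7693323706…` and `δ = 1/γ = 0.3049639859…`
      β = α⁻¹ ∧ δ = γ⁻¹ ∧
      0.7693323706 < β ∧ β < 0.7693323707 ∧
      0.3049639859 < δ ∧ δ < 0.3049639860 ∧
      (fun n : ℕ => (PeaksValleys.f n : ℝ) / (Nat.factorial n : ℝ) - 2 * β ^ (n + 1))
        =O[atTop] (fun n : ℕ => δ ^ n) := by
  obtain ⟨α, hα, hα', hα1, hα2⟩ := PeaksValleys.exists_real_zero
  obtain ⟨ρ, hρ, hρ', hρ0, hρ1, hρ2⟩ := PeaksValleys.exists_upper_zero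
  have hα0 : 0 < α := lt_trans (by norm_num) hα1
  have hργ : 0 < ‖ρ‖ := lt_trans (by norm_num) hρ1
  have hαR : |α| ≤ 3.28 := by
    rw [abs_of_pos hα0]
    exact hα2.le.trans (by norm_num)
  have hρR : ‖ρ‖ < 3.28 := hρ2.trans (by norm_num)
  have hαρ : α < ‖ρ‖ := hα2.trans (lt_trans (by norm_num) hρ1)
  have hleast : ∀ z : ℂ, PeaksValleys.D z = 0 → z ≠ (α : ℂ) → ‖ρ‖ ≤ ‖z‖ := by
    intro z hz hzα
    by_contra hlt
    rcases PeaksValleys.eq_of_D_eq_zero hα hαR hρ hρ0 hρR.le hz (by linarith)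
      with rfl | rfl | rfl
    · exact hzα rfl
    · exact hlt le_rfl
    · exact hlt (by rw [RCLike.norm_conj])
  refine ⟨α, ‖ρ‖, α⁻¹, ‖ρ‖⁻¹, hα0, hα, fun z hz hzα => hαρ.trans_le (hleast z hz hzα),
    ⟨⟨ρ, hρ, ?_, rfl⟩, ?_⟩, rfl, rfl, ?_, ?_, ?_, ?_,
    PeaksValleys.isBigO_coeff hα hα' hαR hρ hρ' hρ0 hρR⟩
  · rintro rfl
    simp at hρ0
  · rintro r ⟨z, hz, hzα, rfl⟩
    exact hleast z hz hzα
  · rw [lt_inv_comm₀ (by norm_num) hα0, ← one_div]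
    exact hα2
  · rw [inv_lt_comm₀ hα0 (by norm_num), ← one_div]
    exact hα1
  · rw [lt_inv_comm₀ (by norm_num) hργ, ← one_div]
    exact hρ2
  · rw [inv_lt_comm₀ hργ (by norm_num), ← one_div]
    exact hρ1
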